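/- **Theorem 1.** *Model.* Consider a network with one macrocell tier, denoted $\mathrm M$, and small-cell tiers $i=2,\dots,K$. The base stations (BSs) of the tiers form independent homogeneous Poisson point processes $\Phi_{\mathrm M},\Phi_2,\dots,\Phi_K$ on $\mathbb R^2$ with densities $\lambda_{\mathrm M},\lambda_i>0$, transmit powers $P_{\mathrm M},P_i>0$ and path loss exponents $\alpha_{\mathrm M},\alpha_i>2$. The path loss at distance $r$ is $L(r)=\beta r^{-\alpha}$ with $\beta>0$ and $\alpha$ the exponent of the BS's tier. A macro BS (MBS) has $N\ge1$ antennas and serves $S\ge1$ users. Let $0<\eta<1$, $0\le\tau\le1$, $T>0$ and a reference distance $d>0$ be given. The typical user is at the origin and $|X|$ denotes the distance of a BS from it. The user is associated with the BS, among all tiers, that maximizes the average received power, which is $(N+S-1)\frac{P_{\mathrm M}}{S}\beta|X|^{-\alpha_{\mathrm M}}$ for an MBS and $P_i\beta|X|^{-\alpha_i}$ for a BS of tier $i$ (DRSP association). Let $|X_o|$ be the distance to the serving BS $o$. The user harvests, if it is associated with an MBS, $$E_{o,\mathrm M}=\eta P_{\mathrm M}h_oL(\max\{|X_o|,d\})\tfrac{\tau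 T}{S}+\eta P_{\mathrm M}h_o'L(\max\{|X_o|,d\})\tfrac{(S-1)\tau T}{S}+\eta\,I\,\tau T,$$ and, if it is associated with a BS of small-cell tier $k$, $$E_{o,k}=\eta P_kg_oL(\max\{|X_o|,d\})\tau T+\eta\, I\,\tau T .$$ Here $I$ is the sum over all BSs $\ell\ne o$ of all tiers of $P_\ell h_\ell L(\max\{|X_\ell|,d\})$, where $P_\ell$ is the transmit power of the tier of $\ell$. The gains $h_o\sim\Gamma(N,1)$, $h'_o\sim\exp(1)$, $g_o\sim\exp(1)$ and $h_\ell\sim\exp(1)$ are independent of each other and of the BS locations. Put $$\hat r_{\mathrm{MS},i}=\Big(\tfrac{(N+S-1)P_{\mathrm M}}{SP_i}\Big)^{-1/\alpha_i},\quad \hat r_{\mathrm{SM},k}=\Big(\tfrac{SP_k}{(N+S-1)P_{\mathrm M}}\Big)^{-1/\alpha_{\mathrm M}},\quad \hat r_{\mathrm{SS},k,i}=\Big(\tfrac{P_k}{P_i}\Big)^{-1/\alpha_i},$$ $$d_{o,i}=\hat r_{\mathrm{MS},i}^{-\alpha_i/\alpha_{\mathrm M}}d^{\alpha_i/\alpha_{\mathrm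 M}},\quad d_{1,k}=\hat r_{\mathrm{SM},k}^{-\alpha_{\mathrm M}/\alpha_k}d^{\alpha_{\mathrm M}/\alpha_k},\quad d_{2,k,i}=\hat r_{\mathrm{SS},k,i}^{-\alpha_i/\alpha_k}d^{\alpha_i/\alpha_k}.$$ *Claim.* Almost surely, in each tier the powers $P_\ell h_\ell L(\max\{|X_\ell|,d\})$ of all its BSs have a finite sum; each of the association events below has positive probability and the harvested energy is integrable on it. Moreover: (a) Given that the user is associated with an MBS and that $|X_o|=x$, the mean of $E_{o,\mathrm M}$ is $$\begin{aligned}\widetilde E_{o,\mathrm M}(x)=\eta\tau T\Big\{&(N+S-1)\tfrac{P_{\mathrm M}}{S}\beta\big(\mathbf 1(x\le d)d^{-\alpha_{\mathrm M}}+\mathbf 1(x>d)x^{-\alpha_{\mathrm M}}\big)\\ &+2\pi\beta P_{\mathrm M}\lambda_{\mathrm M}\Big(\mathbf 1(x\le d)\big(d^{-\alpha_{\mathrm M}}\tfrac{d^2-x^2}{2}-\tfrac{d^{2-\alpha_{\mathrm M}}}{2-\alpha_{\mathrm M}}\big)-\mathbf 1(x>d)\tfrac{x^{2-\alpha_{\mathrm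 M}}}{2-\alpha_{\mathrm M}}\Big)\\ &+\sum_{i=2}^K2\pi\beta P_i\lambda_i\Big(\mathbf 1(x\le d_{o,i})\big(d^{-\alpha_i}\tfrac{d^2-\hat r_{\mathrm{MS},i}^2x^{2\alpha_{\mathrm M}/\alpha_i}}{2}-\tfrac{d^{2-\alpha_i}}{2-\alpha_i}\big)-\mathbf 1(x>d_{o,i})\tfrac{\hat r_{\mathrm{MS},i}^{2-\alpha_i}x^{\alpha_{\mathrm M}(2-\alpha_i)/\alpha_i}}{2-\alpha_i}\Big)\Big\}.\end{aligned}$$ (b) For each $k\in\{2,\dots,K\}$, given that the user is associated with a BS of tier $k$ and that $|X_o|=y$, the mean of $E_{o,k}$ is $$\begin{aligned}\widetilde E_{o,k}(y)=\eta\tau T\Big\{&P_k\beta\big(\mathbf 1(y\le d)d^{-\alpha_k}+\mathbf 1(y>d)y^{-\alpha_k}\big)\\ &+2\pi\beta P_{\mathrm M}\lambda_{\mathrm M}\Big(\mathbf 1(y\le d_{1,k})\big(d^{-\alpha_{\mathrm M}}\tfrac{d^2-\hat r_{\mathrm{SM},k}^2y^{2\alpha_k/\alpha_{\mathrm M}}}{2}-\tfrac{d^{2-\alpha_{\mathrm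 M}}}{2-\alpha_{\mathrm M}}\big)-\mathbf 1(y>d_{1,k})\tfrac{\hat r_{\mathrm{SM},k}^{2-\alpha_{\mathrm M}}y^{\alpha_k(2-\alpha_{\mathrm M})/\alpha_{\mathrm M}}}{2-\alpha_{\mathrm M}}\Big)\\ &+\sum_{i=2}^K2\pi\beta P_i\lambda_i\Big(\mathbf 1(y\le d_{2,k,i})\big(d^{-\alpha_i}\tfrac{d^2-\hat r_{\mathrm{SS},k,i}^2y^{2\alpha_k/\alpha_i}}{2}-\tfrac{d^{2-\alpha_i}}{2-\alpha_i}\big)-\mathbf 1(y>d_{2,k,i})\tfrac{\hat r_{\mathrm{SS},k,i}^{2-\alpha_i}y^{\alpha_k(2-\alpha_i)/\alpha_i}}{2-\alpha_i}\Big)\Big\}.\end{aligned}$$ In both parts "the mean of $E$ given association event $A$ and $|X_o|=x$ is $g(x)$" means that $\mathbb E[E\mid |X_o|]=g(|X_o|)$ almost surely under $\mathbb P(\cdot\mid A)$, and also that for every $x>0$ the events $A\cap\{||X_o|-x|\le\varepsilon\}$, $\varepsilon>0$, have positive probability and $g(x)=\lim_{\varepsilon\downarrow0}\mathbb E\big[E\mid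 A,\ ||X_o|-x|\le\varepsilon\big]$. -/

import Mathlib

open MeasureTheory ProbabilityTheory Filter Topology
open scoped ENNReal

noncomputable section

/-- The Euclidean plane; the typical user sits at the origin. -/
abbrev Plane : Type := EuclideanSpace ℝ (Fin 2)

/-- Number of points of the sequence `X` that lie in `B`. -/
def pointCount {Ω : Type*} (X : ℕ → Ω → Plane) (B : Set Plane) (ω : Ω) : ℕ∞ :=
  {j : ℕ | X j ω ∈ B}.encard

/-- The random points `X 0, X 1, …` enumerate a homogeneous Poisson point process of density `lam`
on the plane: counts of Borel sets of finite area are Poisson, and counts of pairwise disjoint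
Borel sets are independent. (For `lam > 0` such a process has infinitely many points almost
surely, so it is enumerated by a sequence, for instance by increasing distance.) -/
structure IsHomogeneousPPP {Ω : Type*} [MeasurableSpace Ω] (μ : Measure Ω) (lam : ℝ)
    (X : ℕ → Ω → Plane) : Prop where
  measurable : ∀ j, Measurable (X j)
  poisson : ∀ B : Set Plane, MeasurableSet B → volume B ≠ ∞ → ∀ k : ℕ,
    μ {ω | pointCount X B ω = k} = poissonMeasure (lam * (volume B).toReal).toNNReal {k}
  indep : ∀ (m : ℕ) (B : Fin m → Set Plane), (∀ i, MeasurableSet (B i)) →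
    (∀ i j, i ≠ j → Disjoint (B i) (B j)) → iIndepFun (fun i => pointCount X (B i)) μ

/-- Parameters of the network. Tier `0` is the macrocell tier, the tiers `i.succ` with `i : Fin n`
are the `n` small-cell tiers. -/
structure HetNet (n : ℕ) where
  /-- number of antennas of a macro base station -/
  N : ℕ
  /-- number of users served by a macro base station -/
  S : ℕ
  /-- transmit power of each tier -/
  P : Fin (n + 1) → ℝ
  /-- path loss exponent of each tier -/
  α : Fin (n + 1) → ℝ
  /-- density of each tier -/
  lam : Fin (n + 1) → ℝ
  /-- frequency dependent path loss constant -/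
  β : ℝ
  /-- reference distance -/
  d : ℝ
  /-- RF-to-DC conversion efficiency -/
  η : ℝ
  /-- time allocation factor -/
  τ : ℝ
  /-- block duration -/
  T : ℝ

/-- The random fading gains: `directed` is the gain from the serving macro base station while it
beams at the typical user, `shared` the gain from it while it beams at its other users, `small`
the gain from a serving small-cell base station, `ambient i j` the gain from the `j`-th base
station of tier `i` when it is not the serving one. -/
inductive Link (n : ℕ) : Type
  | directed : Link n
  | shared : Link n
  | small : Link n
  | ambient (i : Fin (n + 1)) (j : ℕ) : Link n

namespace HetNet

variable {n : ℕ} {Ω : Type*}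

/-- The admissible range of the parameters. -/
structure Admissible (p : HetNet n) : Prop where
  N_pos : 0 < p.N
  S_pos : 0 < p.S
  P_pos : ∀ i, 0 < p.P i
  α_gt : ∀ i, 2 < p.α i
  lam_pos : ∀ i, 0 < p.lam i
  β_pos : 0 < p.β
  d_pos : 0 < p.d
  η_pos : 0 < p.η
  η_lt : p.η < 1
  τ_nonneg : 0 ≤ p.τ
  τ_le : p.τ ≤ 1
  T_pos : 0 < p.T

/-- Path loss `L(r) = β r ^ (-α)` of tier `i`. -/
def pathLoss (p : HetNet n) (i : Fin (n + 1)) (r : ℝ) : ℝ := p.β * r ^ (-p.α i)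

/-- The downlink power gain `N + S - 1` of a user served by a macro base station. -/
def gain (p : HetNet n) : ℝ := (p.N : ℝ) + (p.S : ℝ) - 1

/-- Average received power of a user connected to the `j`-th base station of tier `i`. -/
def avgPower (p : HetNet n) (X : Fin (n + 1) → ℕ → Ω → Plane) (i : Fin (n + 1)) (j : ℕ) (ω : Ω) :
    ℝ :=
  (if i = 0 then p.gain * (p.P 0 / p.S) else p.P i) * p.pathLoss i ‖X i j ω‖

/-- Association rule: base station `(i, j)` maximizes the average received power among all base
stations of all tiers. -/
def IsServing (p : HetNet n) (X : Fin (n + 1) → ℕ → Ω → Plane) (i : Fin (n + 1)) (j : ℕ) (ω : Ω) :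
    Prop :=
  ∀ (i' : Fin (n + 1)) (j' : ℕ), p.avgPower X i' j' ω ≤ p.avgPower X i j ω

/-- The event that the typical user is associated with a base station of tier `k`. -/
def assoc (p : HetNet n) (X : Fin (n + 1) → ℕ → Ω → Plane) (k : Fin (n + 1)) : Set Ω :=
  {ω | ∃ j, p.IsServing X k j ω}

/-- Index, within tier `k`, of the serving base station (meaningful on `assoc p X k`). -/
def servingIdx (p : HetNet n) (X : Fin (n + 1) → ℕ → Ω → Plane) (k : Fin (n + 1)) (ω : Ω) : ℕ :=
  sInf {j | p.IsServing X k j ω}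

/-- Distance to the serving base station of tier `k` (meaningful on `assoc p X k`). -/
def servingDist (p : HetNet n) (X : Fin (n + 1) → ℕ → Ω → Plane) (k : Fin (n + 1)) (ω : Ω) : ℝ :=
  ‖X k (p.servingIdx X k ω) ω‖

/-- The laws of the fading gains: `Γ(N, 1)` for the directed transfer, `exp(1)` otherwise. -/
def fadingLaw (p : HetNet n) : Link n → Measure ℝ
  | .directed => gammaMeasure (p.N : ℝ) 1
  | .shared => expMeasure 1
  | .small => expMeasure 1
  | .ambient _ _ => expMeasure 1

/-- The probabilistic model: independent homogeneous Poisson tiers, and independent fading gains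
that are independent of the locations. -/
structure IsModel [MeasurableSpace Ω] (p : HetNet n) (μ : Measure Ω)
    (X : Fin (n + 1) → ℕ → Ω → Plane) (H : Link n → Ω → ℝ) : Prop where
  ppp : ∀ i, IsHomogeneousPPP μ (p.lam i) (X i)
  indep_tiers : iIndepFun (fun (i : Fin (n + 1)) (ω : Ω) (j : ℕ) => X i j ω) μ
  measurable_fading : ∀ l, Measurable (H l)
  law_fading : ∀ l, μ.map (H l) = p.fadingLaw l
  indep_fading : iIndepFun H μ
  indep_fading_loc : IndepFun (fun (ω : Ω) (l : Link n) => H l ω)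
    (fun (ω : Ω) (i : Fin (n + 1)) (j : ℕ) => X i j ω) μ

/-- Power received from the `j`-th base station of tier `i` as a non-serving one, with the distance
bounded below by the reference distance. -/
def ambientPower (p : HetNet n) (X : Fin (n + 1) → ℕ → Ω → Plane) (H : Link n → Ω → ℝ)
    (i : Fin (n + 1)) (j : ℕ) (ω : Ω) : ℝ :=
  p.P i * H (.ambient i j) ω * p.pathLoss i (max ‖X i j ω‖ p.d)

/-- Total power received from the base stations of tier `i`, except from the serving one, when the
serving base station belongs to tier `k`. -/
def interference (p : HetNet n) (X : Fin (n + 1) → ℕ → Ω → Plane) (H : Link n → Ω → ℝ)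
    (k i : Fin (n + 1)) (ω : Ω) : ℝ :=
  ∑' j : ℕ, if i = k ∧ j = p.servingIdx X k ω then 0 else p.ambientPower X H i j ω

/-- Energy harvested by a user that is associated with a macro base station: directed, isotropic
and ambient part. -/
def energyMacro (p : HetNet n) (X : Fin (n + 1) → ℕ → Ω → Plane) (H : Link n → Ω → ℝ) (ω : Ω) :
    ℝ :=
  p.η * p.P 0 * H .directed ω * p.pathLoss 0 (max (p.servingDist X 0 ω) p.d) * (p.τ * p.T / p.S)
  + p.η * p.P 0 * H .shared ω * p.pathLoss 0 (max (p.servingDist X 0 ω) p.d)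
      * (((p.S : ℝ) - 1) * p.τ * p.T / p.S)
  + p.η * (p.interference X H 0 0 ω * (p.τ * p.T)
      + (∑ i : Fin n, p.interference X H 0 i.succ ω) * (p.τ * p.T))

/-- Energy harvested by a user that is associated with a base station of the small-cell tier
`k.succ`: isotropic and ambient part. -/
def energySmall (p : HetNet n) (X : Fin (n + 1) → ℕ → Ω → Plane) (H : Link n → Ω → ℝ) (k : Fin n)
    (ω : Ω) : ℝ :=
  p.η * p.P k.succ * H .small ω * p.pathLoss k.succ (max (p.servingDist X k.succ ω) p.d)
      * (p.τ * p.T)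
  + p.η * (p.interference X H k.succ 0 ω + ∑ i : Fin n, p.interference X H k.succ i.succ ω)
      * (p.τ * p.T)

/-- The ratio `r̂_MS` for the small-cell tier `i.succ`. -/
def rMS (p : HetNet n) (i : Fin n) : ℝ :=
  (p.gain * (p.P 0 / (p.S * p.P i.succ))) ^ (-1 / p.α i.succ)

/-- The ratio `r̂_SM` for the small-cell tier `k.succ`. -/
def rSM (p : HetNet n) (k : Fin n) : ℝ :=
  (p.S * p.P k.succ / (p.gain * p.P 0)) ^ (-1 / p.α 0)

/-- The ratio `r̂_SS` for the small-cell tiers `k.succ` and `i.succ`. -/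
def rSS (p : HetNet n) (k i : Fin n) : ℝ :=
  (p.P k.succ / p.P i.succ) ^ (-1 / p.α i.succ)

/-- The threshold `d_o`. -/
def dO (p : HetNet n) (i : Fin n) : ℝ :=
  p.rMS i ^ (-p.α i.succ / p.α 0) * p.d ^ (p.α i.succ / p.α 0)

/-- The threshold `d_1`. -/
def dOne (p : HetNet n) (k : Fin n) : ℝ :=
  p.rSM k ^ (-p.α 0 / p.α k.succ) * p.d ^ (p.α 0 / p.α k.succ)

/-- The threshold `d_2`. -/
def dTwo (p : HetNet n) (k i : Fin n) : ℝ :=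
  p.rSS k i ^ (-p.α i.succ / p.α k.succ) * p.d ^ (p.α i.succ / p.α k.succ)

/-- The closed form of the conditional mean harvested energy, macro case. -/
def meanMacro (p : HetNet n) (x : ℝ) : ℝ :=
  p.η * (((p.N : ℝ) + p.S - 1) * (p.P 0 / p.S) * p.β
        * (if x ≤ p.d then p.d ^ (-p.α 0) else x ^ (-p.α 0))
    + p.P 0 * p.β * 2 * Real.pi * p.lam 0
        * (if x ≤ p.d then
            p.d ^ (-p.α 0) * ((p.d ^ 2 - x ^ 2) / 2) - p.d ^ (2 - p.α 0) / (2 - p.α 0)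
          else -(x ^ (2 - p.α 0) / (2 - p.α 0)))
    + ∑ i : Fin n, p.P i.succ * p.β * 2 * Real.pi * p.lam i.succ
        * (if x ≤ p.dO i then
            p.d ^ (-p.α i.succ) * ((p.d ^ 2 - p.rMS i ^ 2 * x ^ (2 * p.α 0 / p.α i.succ)) / 2)
              - p.d ^ (2 - p.α i.succ) / (2 - p.α i.succ)
          else -(p.rMS i ^ (2 - p.α i.succ) * x ^ (p.α 0 * (2 - p.α i.succ) / p.α i.succ)
              / (2 - p.α i.succ))))
  * (p.τ * p.T)

/-- The closed form of the conditional mean harvested energy, small-cell tier `k.succ`. -/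
def meanSmall (p : HetNet n) (k : Fin n) (y : ℝ) : ℝ :=
  p.η * (p.P k.succ * p.β
        * (if y ≤ p.d then p.d ^ (-p.α k.succ) else y ^ (-p.α k.succ))
    + p.P 0 * p.β * 2 * Real.pi * p.lam 0
        * (if y ≤ p.dOne k then
            p.d ^ (-p.α 0) * ((p.d ^ 2 - p.rSM k ^ 2 * y ^ (2 * p.α k.succ / p.α 0)) / 2)
              - p.d ^ (2 - p.α 0) / (2 - p.α 0)
          else -(p.rSM k ^ (2 - p.α 0) * y ^ (p.α k.succ * (2 - p.α 0) / p.α 0)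
              / (2 - p.α 0)))
    + ∑ i : Fin n, p.P i.succ * p.β * 2 * Real.pi * p.lam i.succ
        * (if y ≤ p.dTwo k i then
            p.d ^ (-p.α i.succ)
                * ((p.d ^ 2 - p.rSS k i ^ 2 * y ^ (2 * p.α k.succ / p.α i.succ)) / 2)
              - p.d ^ (2 - p.α i.succ) / (2 - p.α i.succ)
          else -(p.rSS k i ^ (2 - p.α i.succ)
              * y ^ (p.α k.succ * (2 - p.α i.succ) / p.α i.succ) / (2 - p.α i.succ))))
  * (p.τ * p.T)

end HetNet

/-- `g x` is the mean of `E` given the event `A` and given `R = x`. This says that `g (R)` is the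
conditional expectation of `E` given `R` under `μ` conditioned on `A`, and, so that `g` is pinned
at every single `x > 0`, that `g x` is the limit of the elementary conditional means of `E` given
`A` and `|R - x| ≤ ε`, which are conditional on events of positive probability. -/
structure IsCondMean {Ω : Type*} [MeasurableSpace Ω] (μ : Measure Ω) (A : Set Ω) (R E : Ω → ℝ)
    (g : ℝ → ℝ) : Prop where
  pos : μ A ≠ 0
  measurable : Measurable R
  integrable : Integrable E (cond μ A)
  condExp_eq : condExp (MeasurableSpace.comap R inferInstance) (cond μ A) E
    =ᵐ[cond μ A] fun ω => g (R ω)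
  window_pos : ∀ x : ℝ, 0 < x → ∀ ε : ℝ, 0 < ε → μ (A ∩ {ω | |R ω - x| ≤ ε}) ≠ 0
  tendsto : ∀ x : ℝ, 0 < x →
    Tendsto (fun ε : ℝ => ∫ ω, E ω ∂(cond μ (A ∩ {ω | |R ω - x| ≤ ε}))) (𝓝[>] 0) (𝓝 (g x))

end

/-!
Put all tiers on one scale by the *attenuation* `r ^ α / c` of a base station at distance `r`, where
`c` is the effective power of its tier: the user is served by the base station of least attenuation.
Almost surely no two base stations tie, none is at the origin, and discs contain finitely many
(`HetNet.IsModel.ae_generic`), so association and serving distance are functions of the tierwise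
minima of the attenuation.

The heart of the matter is that, given a serving base station of tier `k` at distance `r`, the other
base stations of tier `i` behave like a fresh Poisson process restricted to the region
`{attenuation k r < attenuation i ‖x‖}`, which is Slivnyak's theorem for this model. It follows from
the independence of counts in disjoint sets without any limit of small windows. For a level `θ`, the
event that the serving attenuation is below `θ`, with any prescription of the serving tier and
distance, depends only on the points of attenuation less than `θ`; hence it is independent of the
number of points of tier `i` in a set of attenuation at least `θ`
(`HetNet.IsModel.indepFun_min_pointCount`). This identifies the joint law of serving distance and
interfering point on rectangles, and countably many such rectangles cover the region above
(`HetNet.IsModel.campbell`).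

Fading is independent of the locations and is averaged out first. The resulting mean of the
interference is the integral of the truncated path loss over the complement of a disc, which is
computed in polar coordinates (`lintegral_max_norm_rpow`). Written with `min` and `max`
(`radialTail`) it is continuous in the serving distance, so that the identity for integrals over
events `{R ∈ B}` (`HasCondMean`) yields both the conditional expectation and the limit over shrinking
windows (`HasCondMean.isCondMean`). The case distinctions of the stated formulas come from comparing
the radius of that disc with the reference distance (`radialTail_mul_rpow`).
-/

/-! ### Counting the points of a Poisson process -/

section PointCount

variable {Ω : Type*} {X : ℕ → Ω → Plane}

lemma toENNReal_pointCount (X : ℕ → Ω → Plane) (B : Set Plane) (ω : Ω) :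
    (pointCount X B ω : ℝ≥0∞) = ∑' j, B.indicator 1 (X j ω) := by
  rw [pointCount, ← ENNReal.tsum_set_one, tsum_subtype {j | X j ω ∈ B} (fun _ => (1 : ℝ≥0∞))]
  rfl

lemma pointCount_eq_zero_iff {B : Set Plane} {ω : Ω} :
    pointCount X B ω = 0 ↔ ∀ j, X j ω ∉ B := by
  simp [pointCount, Set.eq_empty_iff_forall_notMem]

lemma measurable_pointCount [MeasurableSpace Ω] (hX : ∀ j, Measurable (X j)) {B : Set Plane}
    (hB : MeasurableSet B) : Measurable (pointCount X B) := by
  have h : Measurable fun ω => (pointCount X B ω : ℝ≥0∞) := by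
    simp_rw [toENNReal_pointCount]
    exact Measurable.tsum fun j => (measurable_one.indicator hB).comp (hX j)
  refine measurable_to_countable' fun k => ?_
  have : pointCount X B ⁻¹' {k} = (fun ω => (pointCount X B ω : ℝ≥0∞)) ⁻¹' {(k : ℝ≥0∞)} := by
    ext ω; simp
  rw [this]
  exact h (measurableSet_singleton _)

lemma measurableSet_pointCount_eq [MeasurableSpace Ω] (hX : ∀ j, Measurable (X j)) {B : Set Plane}
    (hB : MeasurableSet B) (k : ℕ∞) : MeasurableSet {ω | pointCount X B ω = k} :=
  measurable_pointCount hX hB (measurableSet_singleton k)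

end PointCount

lemma tsum_mul_poissonMeasure (r : NNReal) :
    ∑' k : ℕ, (k : ℝ≥0∞) * poissonMeasure r {k} = r := by
  rw [tsum_eq_zero_add' ENNReal.summable]
  have h : ∀ k : ℕ, ((k + 1 : ℕ) : ℝ≥0∞) * poissonMeasure r {k + 1} = r * poissonMeasure r {k} := by
    intro k
    have h1 : ((k + 1 : ℕ) : ℝ≥0∞) = ENNReal.ofReal (k + 1) := by
      rw [← ENNReal.ofReal_natCast]; simp
    rw [poissonMeasure_singleton, poissonMeasure_singleton, h1, ← ENNReal.ofReal_coe_nnreal,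
      ← ENNReal.ofReal_mul (by positivity), ← ENNReal.ofReal_mul (by positivity)]
    congr 1
    rw [Nat.factorial_succ]
    push_cast
    field_simp
    ring
  simp_rw [h]
  rw [ENNReal.tsum_mul_left]
  have : ∑' k : ℕ, poissonMeasure r {k} = 1 := by
    rw [← measure_iUnion (fun i j hij => by simpa using hij) (fun i => measurableSet_singleton i),
      Set.iUnion_of_singleton, measure_univ]
  simp [this]

namespace IsHomogeneousPPP

variable {Ω : Type*} [MeasurableSpace Ω] {μ : Measure Ω} {lam : ℝ} {X : ℕ → Ω → Plane}

/-- The probability that a set of finite area contains no point. -/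
lemma measure_void (h : IsHomogeneousPPP μ lam X) (hl : 0 ≤ lam) {B : Set Plane}
    (hB : MeasurableSet B) (hv : volume B ≠ ∞) :
    μ {ω | pointCount X B ω = 0} = ENNReal.ofReal (Real.exp (-(lam * (volume B).toReal))) := by
  have := h.poisson B hB hv 0
  rw [poissonMeasure_singleton] at this
  simpa [Real.coe_toNNReal _ (mul_nonneg hl ENNReal.toReal_nonneg)] using this

lemma ae_pointCount_ne_top [IsProbabilityMeasure μ] (h : IsHomogeneousPPP μ lam X) {B : Set Plane}
    (hB : MeasurableSet B) (hv : volume B ≠ ∞) : ∀ᵐ ω ∂μ, pointCount X B ω ≠ ⊤ := by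
  have hm := measurableSet_pointCount_eq h.measurable hB
  have hU : μ (⋃ k : ℕ, {ω | pointCount X B ω = k}) = 1 := by
    rw [measure_iUnion]
    · simp_rw [h.poisson B hB hv]
      rw [← measure_iUnion (fun i j hij => by simpa using hij)
        (fun i => measurableSet_singleton i), Set.iUnion_of_singleton, measure_univ]
    · intro i j hij
      refine Set.disjoint_left.2 fun ω h1 h2 => hij ?_
      have : (i : ℕ∞) = j := h1.symm.trans h2
      exact_mod_cast this
    · exact fun k => hm _
  have := (prob_compl_eq_zero_iff
    (MeasurableSet.iUnion fun k : ℕ => hm k)).2 hU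
  filter_upwards [measure_eq_zero_iff_ae_notMem.1 this] with ω hω htop
  apply hω
  simp [htop]

/-- The mean number of points in a set of finite area. -/
lemma lintegral_pointCount [IsProbabilityMeasure μ] (h : IsHomogeneousPPP μ lam X)
    {B : Set Plane} (hB : MeasurableSet B) (hv : volume B ≠ ∞) :
    ∫⁻ ω, (pointCount X B ω : ℝ≥0∞) ∂μ = ENNReal.ofReal lam * volume B := by
  have hm := measurableSet_pointCount_eq h.measurable hB
  have e : (fun ω => (pointCount X B ω : ℝ≥0∞)) =ᵐ[μ]
      fun ω => ∑' k : ℕ, ({ω | pointCount X B ω = k}).indicator (fun _ => (k : ℝ≥0∞)) ω := by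
    filter_upwards [h.ae_pointCount_ne_top hB hv] with ω hω
    obtain ⟨m, hm⟩ := ENat.ne_top_iff_exists.1 hω
    rw [tsum_eq_single m]
    · simp [← hm]
    · intro k hk
      refine Set.indicator_of_notMem ?_ _
      simp only [Set.mem_ofPred_eq, ← hm]
      exact_mod_cast hk.symm
  rw [lintegral_congr_ae e, lintegral_tsum]
  · have : ∀ k : ℕ, ∫⁻ ω, ({ω | pointCount X B ω = k}).indicator (fun _ => (k : ℝ≥0∞)) ω ∂μ
        = k * poissonMeasure (lam * (volume B).toReal).toNNReal {k} := by
      intro k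
      rw [lintegral_indicator_const (hm k), h.poisson B hB hv]
    simp_rw [this]
    rw [tsum_mul_poissonMeasure, ← ENNReal.ofReal, ENNReal.ofReal_mul' ENNReal.toReal_nonneg,
      ENNReal.ofReal_toReal hv]
  · exact fun k => (measurable_const.indicator (hm k)).aemeasurable

/-- A null set almost surely contains no point. -/
lemma measure_mem_eq_zero [IsProbabilityMeasure μ] (h : IsHomogeneousPPP μ lam X)
    {B : Set Plane} (hB : MeasurableSet B) (hv : volume B = 0) (j : ℕ) :
    μ {ω | X j ω ∈ B} = 0 := by
  have h0 := h.lintegral_pointCount hB (by simp [hv])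
  rw [hv, mul_zero, lintegral_eq_zero_iff] at h0
  · refine measure_eq_zero_iff_ae_notMem.2 ?_
    filter_upwards [h0] with ω hω
    have : pointCount X B ω = 0 := by simpa using hω
    exact pointCount_eq_zero_iff.1 this j
  · simp_rw [toENNReal_pointCount]
    exact Measurable.tsum fun j => (measurable_one.indicator hB).comp (h.measurable j)

/-- A set of small area is unlikely to contain two points. -/
lemma measure_two_le (h : IsHomogeneousPPP μ lam X) [IsProbabilityMeasure μ] (hl : 0 ≤ lam)
    {B : Set Plane} (hB : MeasurableSet B) (hv : volume B ≠ ∞) :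
    μ {ω | 2 ≤ pointCount X B ω} ≤ ENNReal.ofReal ((lam * (volume B).toReal) ^ 2) := by
  have hm := measurableSet_pointCount_eq h.measurable hB
  set t := lam * (volume B).toReal with ht
  have ht0 : 0 ≤ t := mul_nonneg hl ENNReal.toReal_nonneg
  have h0 := h.poisson B hB hv 0
  have h1 := h.poisson B hB hv 1
  rw [poissonMeasure_singleton, ← ht, Real.coe_toNNReal _ ht0] at h0 h1
  have hsub : {ω | 2 ≤ pointCount X B ω} ⊆
      ({ω | pointCount X B ω = (0 : ℕ)} ∪ {ω | pointCount X B ω = (1 : ℕ)})ᶜ := by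
    intro ω hω h
    rcases h with h | h <;> simp only [Set.mem_ofPred_eq] at hω h <;> rw [h] at hω <;>
      exact absurd hω (by decide)
  refine (measure_mono hsub).trans ?_
  rw [prob_compl_eq_one_sub ((hm _).union
    (hm _)), measure_union _ (hm _), h0, h1,
    ← ENNReal.ofReal_add (by positivity) (by positivity), ← ENNReal.ofReal_one,
    ← ENNReal.ofReal_sub _ (by positivity)]
  · refine ENNReal.ofReal_le_ofReal ?_
    have := Real.add_one_le_exp (-t)
    simp only [pow_zero, pow_one, Nat.factorial]
    norm_num
    nlinarith
  · refine Set.disjoint_left.2 fun ω h1 h2 => ?_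
    have : ((0 : ℕ) : ℕ∞) = (1 : ℕ) := h1.symm.trans h2
    exact absurd this (by simp)

end IsHomogeneousPPP

lemma volume_ball_plane (x : Plane) {r : ℝ} (hr : 0 ≤ r) :
    volume (Metric.ball x r) = ENNReal.ofReal (Real.pi * r ^ 2) := by
  rw [EuclideanSpace.volume_ball_fin_two, ← ENNReal.ofReal_pow hr, mul_comm,
    ← ENNReal.ofReal_mul Real.pi_pos.le]

lemma volume_norm_eq (r : ℝ) : volume {x : Plane | ‖x‖ = r} = 0 := by
  have : {x : Plane | ‖x‖ = r} = Metric.sphere 0 r := by ext; simp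
  rw [this]
  exact Measure.addHaar_sphere _ _ _

/-- The annulus of equation `a ≤ ‖x‖ ^ 2 < b` has area `π (b - a)`. -/
lemma volume_annulus {a b : ℝ} (ha : 0 ≤ a) (hab : a ≤ b) :
    volume {x : Plane | a ≤ ‖x‖ ^ 2 ∧ ‖x‖ ^ 2 < b} = ENNReal.ofReal (Real.pi * (b - a)) := by
  have : {x : Plane | a ≤ ‖x‖ ^ 2 ∧ ‖x‖ ^ 2 < b} =
      Metric.ball 0 (Real.sqrt b) \ Metric.ball 0 (Real.sqrt a) := by
    ext x
    simp only [Set.mem_ofPred_eq, Set.mem_sdiff, Metric.mem_ball, dist_zero_right, not_lt]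
    rw [Real.lt_sqrt (norm_nonneg _), Real.sqrt_le_left (norm_nonneg _), and_comm]
  rw [this, measure_sdiff (Metric.ball_subset_ball (Real.sqrt_le_sqrt hab))
    measurableSet_ball.nullMeasurableSet (by simp [volume_ball_plane _ (Real.sqrt_nonneg _)]),
    volume_ball_plane _ (Real.sqrt_nonneg _), volume_ball_plane _ (Real.sqrt_nonneg _),
    Real.sq_sqrt ha, Real.sq_sqrt (ha.trans hab), ← ENNReal.ofReal_sub _ (by positivity), mul_sub]

namespace IsHomogeneousPPP

variable {Ω : Type*} [MeasurableSpace Ω] {μ : Measure Ω} {lam : ℝ} {X : ℕ → Ω → Plane}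

lemma measure_norm_eq_norm_lt [IsProbabilityMeasure μ] (h : IsHomogeneousPPP μ lam X)
    (hl : 0 ≤ lam) {i j : ℕ} (hij : i ≠ j) {D : ℝ} (hD : 0 < D) :
    μ {ω | ‖X i ω‖ = ‖X j ω‖ ∧ ‖X i ω‖ ^ 2 < D} = 0 := by
  -- Cut the disc into `L` annuli of equal area: two equidistant points share an annulus.
  have key : ∀ L : ℕ, 0 < L → μ {ω | ‖X i ω‖ = ‖X j ω‖ ∧ ‖X i ω‖ ^ 2 < D} ≤
      ENNReal.ofReal ((lam * (Real.pi * D)) ^ 2 / L) := by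
    intro L hL
    have hL' : (0 : ℝ) < L := by exact_mod_cast hL
    set hh : ℝ := D / L with hhdef
    have hh0 : 0 < hh := by positivity
    let B : ℕ → Set Plane := fun t => {x | t * hh ≤ ‖x‖ ^ 2 ∧ ‖x‖ ^ 2 < t * hh + hh}
    have hBv : ∀ t, volume (B t) = ENNReal.ofReal (Real.pi * hh) := by
      intro t
      have := volume_annulus (a := t * hh) (b := t * hh + hh) (by positivity) (by linarith)
      rwa [add_sub_cancel_left] at this
    have hBm : ∀ t, MeasurableSet (B t) := fun t =>
      (measurableSet_le measurable_const (measurable_norm.pow_const 2)).inter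
        (measurableSet_lt (measurable_norm.pow_const 2) measurable_const)
    have hsub : {ω | ‖X i ω‖ = ‖X j ω‖ ∧ ‖X i ω‖ ^ 2 < D} ⊆
        ⋃ t ∈ Finset.range L, {ω | 2 ≤ pointCount X (B t) ω} := by
      rintro ω ⟨he, hlt⟩
      simp only [Set.mem_iUnion, Finset.mem_range]
      have hfl : (⌊‖X i ω‖ ^ 2 / hh⌋₊ : ℝ) ≤ ‖X i ω‖ ^ 2 / hh := Nat.floor_le (by positivity)
      have hfl' := Nat.lt_floor_add_one (‖X i ω‖ ^ 2 / hh)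
      rw [le_div_iff₀ hh0] at hfl
      rw [div_lt_iff₀ hh0] at hfl'
      refine ⟨⌊‖X i ω‖ ^ 2 / hh⌋₊, ?_, ?_⟩
      · rw [Nat.floor_lt (by positivity), div_lt_iff₀ hh0, hhdef]
        field_simp
        exact hlt
      · have hi : X i ω ∈ B ⌊‖X i ω‖ ^ 2 / hh⌋₊ := ⟨hfl, by linarith⟩
        have hj : X j ω ∈ B ⌊‖X i ω‖ ^ 2 / hh⌋₊ := by
          change _ ≤ ‖X j ω‖ ^ 2 ∧ ‖X j ω‖ ^ 2 < _
          rw [← he]; exact hi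
        change 2 ≤ Set.encard _
        rw [← Set.encard_pair hij]
        refine Set.encard_le_encard ?_
        rintro k (rfl | rfl)
        exacts [hi, hj]
    calc _ ≤ μ (⋃ t ∈ Finset.range L, {ω | 2 ≤ pointCount X (B t) ω}) := measure_mono hsub
      _ ≤ ∑ t ∈ Finset.range L, μ {ω | 2 ≤ pointCount X (B t) ω} := measure_biUnion_finset_le _ _
      _ ≤ ∑ t ∈ Finset.range L, ENNReal.ofReal ((lam * (Real.pi * hh)) ^ 2) := by
          refine Finset.sum_le_sum fun t _ => ?_
          have := h.measure_two_le hl (hBm t) (by simp [hBv])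
          rwa [hBv, ENNReal.toReal_ofReal (by positivity)] at this
      _ = ENNReal.ofReal ((lam * (Real.pi * D)) ^ 2 / L) := by
          rw [Finset.sum_const, Finset.card_range, nsmul_eq_mul, ← ENNReal.ofReal_natCast,
            ← ENNReal.ofReal_mul (by positivity)]
          congr 1
          rw [hhdef]
          field_simp
  have hlim : Tendsto (fun L : ℕ => ENNReal.ofReal ((lam * (Real.pi * D)) ^ 2 / L)) atTop (𝓝 0) := by
    rw [← ENNReal.ofReal_zero]
    exact (ENNReal.continuous_ofReal.tendsto _).comp (tendsto_const_div_atTop_nhds_zero_nat _)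
  refine le_antisymm (ge_of_tendsto hlim ?_) zero_le
  filter_upwards [eventually_gt_atTop 0] with L hL using key L hL

/-- Almost surely, distinct points of the process have distinct distances to the origin. -/
lemma ae_norm_injective [IsProbabilityMeasure μ] (h : IsHomogeneousPPP μ lam X) (hl : 0 ≤ lam) :
    ∀ᵐ ω ∂μ, ∀ i j, ‖X i ω‖ = ‖X j ω‖ → i = j := by
  rw [ae_all_iff]; intro i
  rw [ae_all_iff]; intro j
  by_cases hij : i = j
  · simp [hij]
  have : ∀ᵐ ω ∂μ, ∀ m : ℕ, ¬ (‖X i ω‖ = ‖X j ω‖ ∧ ‖X i ω‖ ^ 2 < (m : ℝ) + 1) :=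
    ae_all_iff.2 fun m => measure_eq_zero_iff_ae_notMem.1
      (h.measure_norm_eq_norm_lt hl hij (by positivity))
  filter_upwards [this] with ω hω he
  obtain ⟨m, hm⟩ := exists_nat_gt (‖X i ω‖ ^ 2)
  exact absurd ⟨he, hm.trans (lt_add_one _)⟩ (hω m)

/-- Almost surely no point sits at a prescribed distance from the origin. -/
lemma measure_norm_eq [IsProbabilityMeasure μ] (h : IsHomogeneousPPP μ lam X) (j : ℕ) (r : ℝ) :
    μ {ω | ‖X j ω‖ = r} = 0 :=
  h.measure_mem_eq_zero (B := {x | ‖x‖ = r})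
    (measurableSet_eq_fun measurable_norm measurable_const) (volume_norm_eq r) j

/-- Almost surely every disc around the origin contains finitely many points. -/
lemma ae_finite_ball [IsProbabilityMeasure μ] (h : IsHomogeneousPPP μ lam X) :
    ∀ᵐ ω ∂μ, ∀ r : ℝ, {j | ‖X j ω‖ < r}.Finite := by
  have : ∀ᵐ ω ∂μ, ∀ m : ℕ, pointCount X (Metric.ball 0 m) ω ≠ ⊤ :=
    ae_all_iff.2 fun m => h.ae_pointCount_ne_top measurableSet_ball measure_ball_lt_top.ne
  filter_upwards [this] with ω hω r
  obtain ⟨m, hm⟩ := exists_nat_gt r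
  refine (Set.encard_ne_top_iff.1 (hω m)).subset fun j hj => ?_
  simpa using (show ‖X j ω‖ < r from hj).trans hm

end IsHomogeneousPPP

namespace IsHomogeneousPPP

variable {Ω : Type*} [MeasurableSpace Ω] {μ : Measure Ω} {lam : ℝ} {X : ℕ → Ω → Plane}

/-- Campbell's formula for a sum over all the points of the process. -/
lemma tsum_lintegral [IsProbabilityMeasure μ] (h : IsHomogeneousPPP μ lam X)
    {φ : Plane → ℝ≥0∞} (hφ : Measurable φ) :
    ∑' j, ∫⁻ ω, φ (X j ω) ∂μ = ENNReal.ofReal lam * ∫⁻ x, φ x := by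
  have hU : ⋃ m : ℕ, Metric.ball (0 : Plane) m = Set.univ := Metric.iUnion_ball_nat 0
  have key : Measure.sum (fun j => μ.map (X j)) = ENNReal.ofReal lam • volume := by
    rw [← Measure.restrict_univ (μ := Measure.sum _), ← hU,
      ← Measure.restrict_univ (μ := ENNReal.ofReal lam • _), ← hU]
    refine Measure.restrict_iUnion_congr.2 fun m => Measure.ext fun s hs => ?_
    have hsm := hs.inter (measurableSet_ball (x := (0 : Plane)) (ε := m))
    have hv : volume (s ∩ Metric.ball (0 : Plane) m) ≠ ∞ :=
      ne_top_of_le_ne_top measure_ball_lt_top.ne (measure_mono Set.inter_subset_right)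
    rw [Measure.restrict_apply hs, Measure.restrict_apply hs, Measure.sum_apply _ hsm,
      Measure.smul_apply, smul_eq_mul, ← h.lintegral_pointCount hsm hv]
    simp_rw [toENNReal_pointCount]
    refine Eq.trans (tsum_congr fun j => ?_) (lintegral_tsum fun j =>
      ((measurable_one.indicator hsm).comp (h.measurable j)).aemeasurable).symm
    rw [← lintegral_indicator_one hsm]
    exact lintegral_map (measurable_one.indicator hsm) (h.measurable j)
  rw [← smul_eq_mul, ← lintegral_smul_measure, ← key, lintegral_sum_measure]
  exact tsum_congr fun j => (lintegral_map hφ (h.measurable j)).symm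

end IsHomogeneousPPP

/-! ### Radial integrals in the plane -/

/-- The integral `∫_ρ^∞ r (max r d) ^ (-a) dr` of the truncated path loss over the distances beyond
`ρ`, in closed form. With `min` and `max` instead of a case distinction, the expression is visibly
continuous in `ρ`. -/
noncomputable def radialTail (a d ρ : ℝ) : ℝ :=
  d ^ (-a) * ((d ^ 2 - min ρ d ^ 2) / 2) - max ρ d ^ (2 - a) / (2 - a)

lemma radialTail_eq_ite (a d ρ : ℝ) : radialTail a d ρ =
    if ρ ≤ d then d ^ (-a) * ((d ^ 2 - ρ ^ 2) / 2) - d ^ (2 - a) / (2 - a)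
    else -(ρ ^ (2 - a) / (2 - a)) := by
  unfold radialTail
  split_ifs with h
  · rw [min_eq_left h, max_eq_right h]
  · push Not at h
    rw [min_eq_right h.le, max_eq_left h.le]
    ring

lemma continuous_radialTail (a : ℝ) {d : ℝ} (hd : 0 < d) : Continuous (radialTail a d) := by
  unfold radialTail
  refine Continuous.sub (by fun_prop) (Continuous.div_const ?_ _)
  exact (continuous_id.max continuous_const).rpow_const
    fun ρ => Or.inl (hd.trans_le (le_max_right ρ d)).ne'

lemma integrableOn_mul_max_rpow {a d : ℝ} (ha : 2 < a) (hd : 0 < d) (ρ : ℝ) :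
    IntegrableOn (fun y : ℝ => y * max y d ^ (-a)) (Set.Ioi ρ) := by
  have h1 : IntegrableOn (fun y : ℝ => y * max y d ^ (-a)) (Set.Ioi (max ρ d)) := by
    refine (integrableOn_Ioi_rpow_of_lt (a := 1 - a) (by linarith)
      (hd.trans_le (le_max_right ρ d))).congr_fun (fun y hy => ?_) measurableSet_Ioi
    have hy' : d < y := (le_max_right ρ d).trans_lt hy
    simp only
    rw [max_eq_left hy'.le, sub_eq_add_neg, Real.rpow_add (hd.trans hy'), Real.rpow_one]
  have hc : Continuous fun y : ℝ => y * max y d ^ (-a) :=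
    continuous_id.mul ((continuous_id.max continuous_const).rpow_const
      fun ρ => Or.inl (hd.trans_le (le_max_right ρ d)).ne')
  have h2 : IntegrableOn (fun y : ℝ => y * max y d ^ (-a)) (Set.Ioc ρ (max ρ d)) :=
    hc.integrableOn_Ioc
  rw [← Set.Ioc_union_Ioi_eq_Ioi (le_max_left ρ d)]
  exact h2.union h1

lemma integral_mul_max_rpow {a d : ℝ} (ha : 2 < a) (hd : 0 < d) (ρ : ℝ) :
    ∫ y in Set.Ioi ρ, y * max y d ^ (-a) = radialTail a d ρ := by
  have hI := integrableOn_mul_max_rpow ha hd ρ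
  have hm := le_max_left ρ d
  rw [← Set.Ioc_union_Ioi_eq_Ioi hm] at hI ⊢
  rw [setIntegral_union (Set.Ioc_disjoint_Ioi le_rfl) measurableSet_Ioi hI.left_of_union
    hI.right_of_union]
  have e1 : ∫ y in Set.Ioc ρ (max ρ d), y * max y d ^ (-a)
      = d ^ (-a) * ((d ^ 2 - min ρ d ^ 2) / 2) := by
    rcases le_total ρ d with h | h
    · rw [max_eq_right h, min_eq_left h, ← intervalIntegral.integral_of_le h]
      rw [intervalIntegral.integral_congr (g := fun y => y * d ^ (-a))]
      · rw [intervalIntegral.integral_mul_const, integral_id, mul_comm]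
      · intro y hy
        rw [Set.uIcc_of_le h] at hy
        simp only [max_eq_right hy.2]
    · rw [max_eq_left h, min_eq_right h]; simp
  have e2 : ∫ y in Set.Ioi (max ρ d), y * max y d ^ (-a) = -(max ρ d ^ (2 - a) / (2 - a)) := by
    rw [setIntegral_congr_fun (g := fun y : ℝ => y ^ (1 - a)) measurableSet_Ioi]
    · rw [integral_Ioi_rpow_of_lt (by linarith) (hd.trans_le (le_max_right ρ d))]
      rw [show 1 - a + 1 = 2 - a by ring, neg_div]
    · intro y hy
      have hy' : d < y := (le_max_right ρ d).trans_lt hy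
      simp only
      rw [max_eq_left hy'.le, sub_eq_add_neg, Real.rpow_add (hd.trans hy'), Real.rpow_one]
  rw [e1, e2, radialTail, ← sub_eq_add_neg]

lemma radialTail_nonneg {a d ρ : ℝ} (ha : 2 < a) (hd : 0 < d) (hρ : 0 ≤ ρ) :
    0 ≤ radialTail a d ρ := by
  rw [← integral_mul_max_rpow ha hd]
  refine setIntegral_nonneg measurableSet_Ioi fun y hy => ?_
  exact mul_nonneg (hρ.trans (le_of_lt hy)) (Real.rpow_nonneg (hd.le.trans (le_max_right y d)) _)

/-- The truncated path loss, integrated over the complement of a disc. -/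
lemma lintegral_max_norm_rpow {a d ρ : ℝ} (ha : 2 < a) (hd : 0 < d) (hρ : 0 ≤ ρ) :
    ∫⁻ x in {x : Plane | ρ < ‖x‖}, ENNReal.ofReal (max ‖x‖ d ^ (-a)) =
      ENNReal.ofReal (2 * Real.pi * radialTail a d ρ) := by
  set f : ℝ → ℝ := (Set.Ioi ρ).indicator fun y => max y d ^ (-a) with hf
  have hms : MeasurableSet {x : Plane | ρ < ‖x‖} := measurableSet_lt measurable_const measurable_norm
  have hf0 : ∀ y, 0 ≤ f y := fun y => Set.indicator_nonneg
    (fun y _ => Real.rpow_nonneg (hd.le.trans (le_max_right y d)) _) y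
  have hind : (fun y : ℝ => y ^ (Module.finrank ℝ Plane - 1) • f y)
      = (Set.Ioi ρ).indicator fun y => y * max y d ^ (-a) := by
    ext y
    simp only [hf, finrank_euclideanSpace, Fintype.card_fin]
    by_cases hy : y ∈ Set.Ioi ρ <;> simp [hy]
  have hsub : Set.Ioi (0 : ℝ) ∩ Set.Ioi ρ = Set.Ioi ρ :=
    Set.inter_eq_right.2 (Set.Ioi_subset_Ioi hρ)
  have hint : Integrable (fun x : Plane => f ‖x‖) := by
    rw [integrable_fun_norm_addHaar volume, hind, IntegrableOn,
      integrable_indicator_iff measurableSet_Ioi, IntegrableOn,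
      Measure.restrict_restrict measurableSet_Ioi, Set.inter_comm, hsub]
    exact integrableOn_mul_max_rpow ha hd ρ
  have hval : ∫ x : Plane, f ‖x‖ = 2 * Real.pi * radialTail a d ρ := by
    rw [integral_fun_norm_addHaar volume, hind, setIntegral_indicator measurableSet_Ioi, hsub,
      integral_mul_max_rpow ha hd, measureReal_def, volume_ball_plane _ zero_le_one,
      ENNReal.toReal_ofReal (by positivity), finrank_euclideanSpace, Fintype.card_fin]
    simp [mul_assoc]
  rw [← hval, ofReal_integral_eq_lintegral_ofReal hint (ae_of_all _ fun x => hf0 _),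
    ← lintegral_indicator hms]
  refine lintegral_congr fun x => ?_
  by_cases hx : ρ < ‖x‖
  · rw [Set.indicator_of_mem (by exact hx), hf, Set.indicator_of_mem (by exact hx)]
  · rw [Set.indicator_of_notMem (by exact hx), hf, Set.indicator_of_notMem (by exact hx),
      ENNReal.ofReal_zero]

/-! ### Fading gains -/

lemma ae_nonneg_gammaMeasure (a r : ℝ) : ∀ᵐ x ∂gammaMeasure a r, 0 ≤ x := by
  rw [ae_iff]
  simp only [not_le]
  change gammaMeasure a r (Set.Iio 0) = 0
  rw [gammaMeasure, withDensity_apply _ measurableSet_Iio]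
  exact lintegral_gammaPDF_of_nonpos le_rfl

lemma lintegral_ofReal_gammaMeasure {a : ℝ} (ha : 0 < a) :
    ∫⁻ x, ENNReal.ofReal x ∂gammaMeasure a 1 = ENNReal.ofReal a := by
  have hm : ∀ b, Measurable (gammaPDF b 1) := fun b => (measurable_gammaPDFReal b 1).ennreal_ofReal
  rw [gammaMeasure, lintegral_withDensity_eq_lintegral_mul _ (hm a) ENNReal.measurable_ofReal]
  have : ∀ x : ℝ, (gammaPDF a 1 * fun x => ENNReal.ofReal x) x
      = ENNReal.ofReal a * gammaPDF (a + 1) 1 x := by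
    intro x
    rcases lt_or_ge x 0 with hx | hx
    · simp [gammaPDF_of_neg hx]
    · have hG := Real.Gamma_pos_of_pos ha
      rw [Pi.mul_apply, gammaPDF_of_nonneg hx, gammaPDF_of_nonneg hx, ← ENNReal.ofReal_mul
        (by positivity), ← ENNReal.ofReal_mul ha.le, Real.Gamma_add_one ha.ne', add_sub_cancel_right]
      congr 1
      have : x ^ a = x ^ (a - 1) * x := by
        rcases hx.eq_or_lt with rfl | hx
        · simp [Real.zero_rpow ha.ne']
        · rw [← Real.rpow_add_one hx.ne', sub_add_cancel]
      rw [this]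
      simp only [Real.one_rpow]
      field_simp
  simp_rw [this]
  rw [lintegral_const_mul _ (hm _), lintegral_gammaPDF_eq_one (by linarith) one_pos, mul_one]

/-! ### Attenuation and the serving base station -/

namespace HetNet

variable {n : ℕ} {Ω : Type*} {p : HetNet n} {X : Fin (n + 1) → ℕ → Ω → Plane}

/-- The effective transmit power of tier `i` in the association rule, including the array gain of
the macro base stations. -/
noncomputable def assocPower (p : HetNet n) (i : Fin (n + 1)) : ℝ :=
  if i = 0 then p.gain * (p.P 0 / p.S) else p.P i

/-- The reciprocal `r ^ α / c` of the average power received at distance `r` from a base station of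
tier `i`, up to the factor `β`. The serving base station minimizes it. It puts all tiers on one
scale, and unlike the average power it is also correct at distance `0`. -/
noncomputable def attenuation (p : HetNet n) (i : Fin (n + 1)) (r : ℝ) : ℝ :=
  r ^ p.α i / p.assocPower i

/-- The distance at which tier `i` has attenuation `w`. -/
noncomputable def distOfAttenuation (p : HetNet n) (i : Fin (n + 1)) (w : ℝ) : ℝ :=
  (p.assocPower i * w) ^ (1 / p.α i)

/-- The smallest attenuation of the points `x 0, x 1, …` of tier `i`. -/
noncomputable def minAttenuation (p : HetNet n) (i : Fin (n + 1)) (x : ℕ → Plane) : ℝ :=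
  ⨅ j, p.attenuation i ‖x j‖

lemma Admissible.one_le_gain (hp : p.Admissible) : 1 ≤ p.gain := by
  have h1 : (1 : ℝ) ≤ p.N := by exact_mod_cast hp.N_pos
  have h2 : (1 : ℝ) ≤ p.S := by exact_mod_cast hp.S_pos
  unfold gain; linarith

lemma Admissible.S_cast_pos (hp : p.Admissible) : (0 : ℝ) < p.S := by exact_mod_cast hp.S_pos

lemma Admissible.assocPower_pos (hp : p.Admissible) (i : Fin (n + 1)) : 0 < p.assocPower i := by
  unfold assocPower
  split_ifs
  · exact mul_pos (one_pos.trans_le hp.one_le_gain) (div_pos (hp.P_pos 0) hp.S_cast_pos)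
  · exact hp.P_pos i

lemma Admissible.α_pos (hp : p.Admissible) (i : Fin (n + 1)) : 0 < p.α i :=
  two_pos.trans (hp.α_gt i)

lemma Admissible.attenuation_nonneg (hp : p.Admissible) (i : Fin (n + 1)) {r : ℝ} (hr : 0 ≤ r) :
    0 ≤ p.attenuation i r :=
  div_nonneg (Real.rpow_nonneg hr _) (hp.assocPower_pos i).le

lemma Admissible.attenuation_pos (hp : p.Admissible) (i : Fin (n + 1)) {r : ℝ} (hr : 0 < r) :
    0 < p.attenuation i r :=
  div_pos (Real.rpow_pos_of_pos hr _) (hp.assocPower_pos i)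

lemma Admissible.attenuation_le_iff (hp : p.Admissible) (i : Fin (n + 1)) {r s : ℝ} (hr : 0 ≤ r)
    (hs : 0 ≤ s) : p.attenuation i r ≤ p.attenuation i s ↔ r ≤ s := by
  unfold attenuation
  rw [div_le_div_iff_of_pos_right (hp.assocPower_pos i), Real.rpow_le_rpow_iff hr hs (hp.α_pos i)]

lemma Admissible.attenuation_lt_iff (hp : p.Admissible) (i : Fin (n + 1)) {r s : ℝ} (hr : 0 ≤ r)
    (hs : 0 ≤ s) : p.attenuation i r < p.attenuation i s ↔ r < s := by
  rw [← not_le, ← not_le, hp.attenuation_le_iff i hs hr]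

lemma Admissible.distOfAttenuation_nonneg (hp : p.Admissible) (i : Fin (n + 1)) {w : ℝ}
    (hw : 0 ≤ w) : 0 ≤ p.distOfAttenuation i w :=
  Real.rpow_nonneg (mul_nonneg (hp.assocPower_pos i).le hw) _

lemma Admissible.attenuation_distOfAttenuation (hp : p.Admissible) (i : Fin (n + 1)) {w : ℝ}
    (hw : 0 ≤ w) : p.attenuation i (p.distOfAttenuation i w) = w := by
  have hc := hp.assocPower_pos i
  unfold attenuation distOfAttenuation
  rw [← Real.rpow_mul (mul_nonneg hc.le hw), one_div_mul_cancel (hp.α_pos i).ne', Real.rpow_one]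
  field_simp

lemma Admissible.distOfAttenuation_attenuation (hp : p.Admissible) (i : Fin (n + 1)) {r : ℝ}
    (hr : 0 ≤ r) : p.distOfAttenuation i (p.attenuation i r) = r := by
  have hc := hp.assocPower_pos i
  unfold attenuation distOfAttenuation
  rw [mul_div_cancel₀ _ hc.ne', ← Real.rpow_mul hr, mul_one_div_cancel (hp.α_pos i).ne',
    Real.rpow_one]

lemma Admissible.lt_attenuation_iff (hp : p.Admissible) (i : Fin (n + 1)) {w r : ℝ} (hw : 0 ≤ w)
    (hr : 0 ≤ r) : w < p.attenuation i r ↔ p.distOfAttenuation i w < r := by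
  rw [← hp.attenuation_lt_iff i (hp.distOfAttenuation_nonneg i hw) hr,
    hp.attenuation_distOfAttenuation i hw]

lemma Admissible.attenuation_lt_iff_lt_dist (hp : p.Admissible) (i : Fin (n + 1)) {w r : ℝ}
    (hw : 0 ≤ w) (hr : 0 ≤ r) : p.attenuation i r < w ↔ r < p.distOfAttenuation i w := by
  rw [← hp.attenuation_lt_iff i hr (hp.distOfAttenuation_nonneg i hw),
    hp.attenuation_distOfAttenuation i hw]

@[fun_prop]
lemma measurable_attenuation (i : Fin (n + 1)) : Measurable (p.attenuation i) :=
  (measurable_id.pow_const _).div_const _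

@[fun_prop]
lemma measurable_distOfAttenuation (i : Fin (n + 1)) : Measurable (p.distOfAttenuation i) :=
  (measurable_id.const_mul _).pow_const _

lemma measurable_minAttenuation (i : Fin (n + 1)) : Measurable (p.minAttenuation i) := by
  unfold minAttenuation
  exact Measurable.iInf fun j =>
    (measurable_attenuation i).comp (measurable_norm.comp (measurable_pi_apply j))

lemma Admissible.bddBelow_attenuation (hp : p.Admissible) (i : Fin (n + 1)) (x : ℕ → Plane) :
    BddBelow (Set.range fun j => p.attenuation i ‖x j‖) :=
  ⟨0, by rintro _ ⟨j, rfl⟩; exact hp.attenuation_nonneg i (norm_nonneg _)⟩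

lemma Admissible.minAttenuation_le (hp : p.Admissible) (i : Fin (n + 1)) (x : ℕ → Plane) (j : ℕ) :
    p.minAttenuation i x ≤ p.attenuation i ‖x j‖ :=
  ciInf_le (hp.bddBelow_attenuation i x) j

lemma Admissible.le_minAttenuation_iff (hp : p.Admissible) (i : Fin (n + 1)) (x : ℕ → Plane)
    (w : ℝ) : w ≤ p.minAttenuation i x ↔ ∀ j, w ≤ p.attenuation i ‖x j‖ :=
  le_ciInf_iff (hp.bddBelow_attenuation i x)

lemma Admissible.le_minAttenuation_iff_pointCount (hp : p.Admissible) (i : Fin (n + 1)) (ω : Ω)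
    (w : ℝ) : w ≤ p.minAttenuation i (fun j => X i j ω) ↔
      pointCount (X i) {x | p.attenuation i ‖x‖ < w} ω = 0 := by
  rw [hp.le_minAttenuation_iff, pointCount_eq_zero_iff]
  simp

/-- The almost sure properties of the base station locations: no base station sits at the origin,
each disc contains finitely many base stations of each tier, and no two base stations have the same
attenuation. -/
structure Generic (p : HetNet n) (X : Fin (n + 1) → ℕ → Ω → Plane) (ω : Ω) : Prop where
  norm_pos : ∀ i j, 0 < ‖X i j ω‖
  finite : ∀ i, ∀ r : ℝ, {j | ‖X i j ω‖ < r}.Finite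
  no_ties : ∀ i j i' j', p.attenuation i ‖X i j ω‖ = p.attenuation i' ‖X i' j' ω‖ →
    i = i' ∧ j = j'

namespace Generic

variable {ω : Ω}

lemma exists_eq_minAttenuation (hg : Generic p X ω) (hp : p.Admissible) (i : Fin (n + 1)) :
    ∃ j, p.attenuation i ‖X i j ω‖ = p.minAttenuation i (fun j => X i j ω) := by
  obtain ⟨j, hj, hmin⟩ := Set.exists_min_image {j | ‖X i j ω‖ < ‖X i 0 ω‖ + 1}
    (fun j => ‖X i j ω‖) (hg.finite i _) ⟨0, by simp⟩
  refine ⟨j, le_antisymm ((hp.le_minAttenuation_iff i _ _).2 fun l => ?_)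
    (hp.minAttenuation_le i _ j)⟩
  rw [hp.attenuation_le_iff i (norm_nonneg _) (norm_nonneg _)]
  rcases lt_or_ge ‖X i l ω‖ (‖X i 0 ω‖ + 1) with h | h
  · exact hmin l h
  · exact (le_of_lt hj).trans h

lemma avgPower_eq (hg : Generic p X ω) (hp : p.Admissible) (i : Fin (n + 1)) (j : ℕ) :
    p.avgPower X i j ω = p.β / p.attenuation i ‖X i j ω‖ := by
  have h1 := hp.assocPower_pos i
  have h2 := Real.rpow_pos_of_pos (hg.norm_pos i j) (p.α i)
  change p.assocPower i * (p.β * _) = _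
  rw [attenuation, Real.rpow_neg (norm_nonneg _)]
  field_simp

lemma isServing_iff (hg : Generic p X ω) (hp : p.Admissible) (k : Fin (n + 1)) (j : ℕ) :
    p.IsServing X k j ω ↔ ∀ i, p.attenuation k ‖X k j ω‖ ≤ p.minAttenuation i (fun j => X i j ω) := by
  simp_rw [hp.le_minAttenuation_iff, IsServing, hg.avgPower_eq hp]
  refine forall_congr' fun i => forall_congr' fun l => ?_
  exact div_le_div_iff_of_pos_left hp.β_pos (hp.attenuation_pos i (hg.norm_pos i l))
    (hp.attenuation_pos k (hg.norm_pos k j))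

lemma mem_assoc_iff (hg : Generic p X ω) (hp : p.Admissible) (k : Fin (n + 1)) : ω ∈ p.assoc X k ↔
    ∀ i, p.minAttenuation k (fun j => X k j ω) ≤ p.minAttenuation i (fun j => X i j ω) := by
  constructor
  · rintro ⟨j, hj⟩ i
    exact (hp.minAttenuation_le k _ j).trans ((hg.isServing_iff hp k j).1 hj i)
  · intro h
    obtain ⟨j, hj⟩ := hg.exists_eq_minAttenuation hp k
    exact ⟨j, (hg.isServing_iff hp k j).2 fun i => hj ▸ h i⟩

lemma attenuation_servingDist (hg : Generic p X ω) (hp : p.Admissible)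
    {k : Fin (n + 1)} (hω : ω ∈ p.assoc X k) :
    p.attenuation k (p.servingDist X k ω) = p.minAttenuation k (fun j => X k j ω) := by
  have h : p.IsServing X k (p.servingIdx X k ω) ω := Nat.sInf_mem (s := {j | p.IsServing X k j ω}) hω
  exact le_antisymm ((hg.isServing_iff hp k _).1 h k) (hp.minAttenuation_le k _ _)

lemma servingDist_eq (hg : Generic p X ω) (hp : p.Admissible)
    {k : Fin (n + 1)} (hω : ω ∈ p.assoc X k) :
    p.servingDist X k ω = p.distOfAttenuation k (p.minAttenuation k (fun j => X k j ω)) := by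
  rw [← hg.attenuation_servingDist hp hω]
  exact (hp.distOfAttenuation_attenuation k (norm_nonneg _)).symm

lemma attenuation_servingDist_lt (hg : Generic p X ω) (hp : p.Admissible)
    {k i : Fin (n + 1)} {j : ℕ} (hω : ω ∈ p.assoc X k)
    (hij : ¬ (i = k ∧ j = p.servingIdx X k ω)) :
    p.attenuation k (p.servingDist X k ω) < p.attenuation i ‖X i j ω‖ := by
  refine lt_of_le_of_ne ?_ fun h => ?_
  · rw [hg.attenuation_servingDist hp hω]
    exact ((hg.mem_assoc_iff hp k).1 hω i).trans (hp.minAttenuation_le i _ j)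
  · obtain ⟨h1, h2⟩ := hg.no_ties _ _ _ _ h
    exact hij ⟨h1.symm, h2.symm⟩

end Generic

section Measurability

variable [MeasurableSpace Ω]

lemma measurableSet_isServing (hX : ∀ i j, Measurable (X i j)) (k : Fin (n + 1)) (j : ℕ) :
    MeasurableSet {ω | p.IsServing X k j ω} := by
  have hm : ∀ i j, Measurable (p.avgPower X i j) := fun i j =>
    (((hX i j).norm.pow_const _).const_mul _).const_mul _
  have : {ω | p.IsServing X k j ω} =
      ⋂ i, ⋂ l, {ω | p.avgPower X i l ω ≤ p.avgPower X k j ω} := by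
    ext ω; simp [IsServing]
  rw [this]
  exact MeasurableSet.iInter fun i => MeasurableSet.iInter fun l =>
    measurableSet_le (hm i l) (hm k j)

lemma measurableSet_assoc (hX : ∀ i j, Measurable (X i j)) (k : Fin (n + 1)) :
    MeasurableSet (p.assoc X k) := by
  have : p.assoc X k = ⋃ j, {ω | p.IsServing X k j ω} := by ext ω; simp [assoc]
  rw [this]
  exact MeasurableSet.iUnion fun j => measurableSet_isServing hX k j

lemma measurable_servingIdx (hX : ∀ i j, Measurable (X i j)) (k : Fin (n + 1)) :
    Measurable (p.servingIdx X k) := by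
  refine measurable_to_countable' fun m => ?_
  have hm := fun j => measurableSet_isServing (p := p) hX k j
  have : p.servingIdx X k ⁻¹' {m} =
      ({ω | p.IsServing X k m ω} ∩ ⋂ l ∈ Set.Iio m, {ω | p.IsServing X k l ω}ᶜ) ∪
        {ω | m = 0 ∧ ω ∈ (p.assoc X k)ᶜ} := by
    ext ω
    simp only [Set.mem_preimage, Set.mem_singleton_iff, Set.mem_union, Set.mem_inter_iff,
      Set.mem_iInter, Set.mem_Iio, Set.mem_compl_iff, Set.mem_ofPred_eq]
    constructor
    · rintro rfl
      by_cases h : ω ∈ p.assoc X k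
      · exact Or.inl ⟨Nat.sInf_mem (s := {j | p.IsServing X k j ω}) h,
          fun l hl => Nat.notMem_of_lt_sInf hl⟩
      · refine Or.inr ⟨?_, h⟩
        have : {j | p.IsServing X k j ω} = ∅ :=
          Set.eq_empty_iff_forall_notMem.2 fun j hj => h ⟨j, hj⟩
        simp [servingIdx, this]
    · rintro (⟨h1, h2⟩ | ⟨rfl, h⟩)
      · refine le_antisymm (Nat.sInf_le h1) (not_lt.1 fun hlt => h2 _ hlt ?_)
        exact Nat.sInf_mem (s := {j | p.IsServing X k j ω}) ⟨m, h1⟩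
      · have : {j | p.IsServing X k j ω} = ∅ :=
          Set.eq_empty_iff_forall_notMem.2 fun j hj => h ⟨j, hj⟩
        simp [servingIdx, this]
  rw [this]
  refine ((hm m).inter (MeasurableSet.biInter (Set.to_countable _) fun l _ => (hm l).compl)).union ?_
  by_cases h : m = 0
  · simp only [h, true_and]
    exact (measurableSet_assoc hX k).compl
  · simp [h]

lemma measurable_servingDist (hX : ∀ i j, Measurable (X i j)) (k : Fin (n + 1)) :
    Measurable (p.servingDist X k) := by
  have h : Measurable fun q : ℕ × Ω => ‖X k q.1 q.2‖ :=
    measurable_from_prod_countable_right fun j => (hX k j).norm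
  have e : p.servingDist X k =
      (fun q : ℕ × Ω => ‖X k q.1 q.2‖) ∘ fun ω => (p.servingIdx X k ω, ω) := rfl
  rw [e]
  exact h.comp ((measurable_servingIdx hX k).prodMk measurable_id)

/-- The event that tier `k` serves, but not through the base station `(i, j)`, is measurable. -/
lemma measurableSet_assoc_not_serving (hX : ∀ i j, Measurable (X i j)) (k i : Fin (n + 1))
    (j : ℕ) : MeasurableSet (p.assoc X k ∩ {ω | ¬ (i = k ∧ j = p.servingIdx X k ω)}) := by
  refine (measurableSet_assoc hX k).inter
    (MeasurableSet.compl (s := {ω | i = k ∧ j = p.servingIdx X k ω}) ?_)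
  exact (MeasurableSet.const _).inter
    (measurableSet_eq_fun measurable_const (measurable_servingIdx hX k))

end Measurability

lemma servingDist_nonneg (k : Fin (n + 1)) (ω : Ω) : 0 ≤ p.servingDist X k ω := norm_nonneg _

namespace IsModel

variable [MeasurableSpace Ω] {μ : Measure Ω} {H : Link n → Ω → ℝ}

lemma measurable_loc (hM : p.IsModel μ X H) (i : Fin (n + 1)) (j : ℕ) : Measurable (X i j) :=
  (hM.ppp i).measurable j

/-- Base stations of different tiers almost surely have different attenuations: the tiers are
independent, and no circle around the origin carries a base station. -/
lemma measure_attenuation_eq [IsProbabilityMeasure μ] (hM : p.IsModel μ X H) (hp : p.Admissible)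
    {i i' : Fin (n + 1)} (hi : i ≠ i') (j j' : ℕ) :
    μ {ω | p.attenuation i ‖X i j ω‖ = p.attenuation i' ‖X i' j' ω‖} = 0 := by
  have hind : IndepFun (fun ω => p.attenuation i ‖X i j ω‖)
      (fun ω => p.attenuation i' ‖X i' j' ω‖) μ :=
    (hM.indep_tiers.indepFun hi).comp
      (φ := fun x : ℕ → Plane => p.attenuation i ‖x j‖)
      (ψ := fun x : ℕ → Plane => p.attenuation i' ‖x j'‖)
      ((measurable_attenuation i).comp (measurable_norm.comp (measurable_pi_apply j)))
      ((measurable_attenuation i').comp (measurable_norm.comp (measurable_pi_apply j')))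
  have hm1 : Measurable (fun ω => p.attenuation i ‖X i j ω‖) :=
    (measurable_attenuation i).comp (hM.measurable_loc i j).norm
  have hm2 : Measurable (fun ω => p.attenuation i' ‖X i' j' ω‖) :=
    (measurable_attenuation i').comp (hM.measurable_loc i' j').norm
  have hlaw := (indepFun_iff_map_prod_eq_prod_map_map hm1.aemeasurable hm2.aemeasurable).1 hind
  have hD : MeasurableSet {q : ℝ × ℝ | q.1 = q.2} := measurableSet_eq_fun measurable_fst measurable_snd
  have : μ {ω | p.attenuation i ‖X i j ω‖ = p.attenuation i' ‖X i' j' ω‖} =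
      μ.map (fun ω => (p.attenuation i ‖X i j ω‖, p.attenuation i' ‖X i' j' ω‖))
        {q : ℝ × ℝ | q.1 = q.2} := by
    rw [Measure.map_apply (hm1.prodMk hm2) hD]; rfl
  have := Measure.isProbabilityMeasure_map (μ := μ) hm2.aemeasurable
  rw [‹μ _ = _›, hlaw, Measure.prod_apply hD]
  refine (lintegral_congr fun w => ?_).trans lintegral_zero
  rw [Measure.map_apply hm2 (measurable_prodMk_left hD)]
  refine measure_mono_null (t := {ω | ‖X i' j' ω‖ = p.distOfAttenuation i' w}) ?_
    ((hM.ppp i').measure_norm_eq j' _)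
  intro ω hω
  have hω' : w = p.attenuation i' ‖X i' j' ω‖ := hω
  simp [hω', hp.distOfAttenuation_attenuation i' (norm_nonneg _)]

lemma ae_generic [IsProbabilityMeasure μ] (hM : p.IsModel μ X H) (hp : p.Admissible) :
    ∀ᵐ ω ∂μ, Generic p X ω := by
  have h1 : ∀ᵐ ω ∂μ, ∀ i j, ‖X i j ω‖ ≠ 0 := ae_all_iff.2 fun i => ae_all_iff.2 fun j =>
    measure_eq_zero_iff_ae_notMem.1 ((hM.ppp i).measure_norm_eq j 0)
  have h2 : ∀ᵐ ω ∂μ, ∀ i, ∀ r : ℝ, {j | ‖X i j ω‖ < r}.Finite :=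
    ae_all_iff.2 fun i => (hM.ppp i).ae_finite_ball
  have h3 : ∀ᵐ ω ∂μ, ∀ i j j', ‖X i j ω‖ = ‖X i j' ω‖ → j = j' :=
    ae_all_iff.2 fun i => (hM.ppp i).ae_norm_injective (hp.lam_pos i).le
  have h4 : ∀ᵐ ω ∂μ, ∀ i i' : Fin (n + 1), i ≠ i' → ∀ j j',
      p.attenuation i ‖X i j ω‖ ≠ p.attenuation i' ‖X i' j' ω‖ := by
    refine ae_all_iff.2 fun i => ae_all_iff.2 fun i' => ?_
    by_cases hi : i = i'
    · simp [hi]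
    · filter_upwards [ae_all_iff.2 fun j => ae_all_iff.2 fun j' => measure_eq_zero_iff_ae_notMem.1
        (hM.measure_attenuation_eq hp hi j j')] with ω hω _ j j' using hω j j'
  filter_upwards [h1, h2, h3, h4] with ω h1 h2 h3 h4
  refine ⟨fun i j => (norm_nonneg _).lt_of_ne' (h1 i j), h2, fun i j i' j' h => ?_⟩
  by_cases hi : i = i'
  · subst hi
    refine ⟨rfl, h3 i j j' ?_⟩
    rw [← hp.distOfAttenuation_attenuation i (norm_nonneg (X i j ω)), h,
      hp.distOfAttenuation_attenuation i (norm_nonneg _)]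
  · exact absurd h (h4 i i' hi j j')

end IsModel

end HetNet

/-! ### The serving base station screens off the points behind it -/

namespace HetNet

variable {n : ℕ} {Ω : Type*} [MeasurableSpace Ω] {μ : Measure Ω}
  {p : HetNet n} {X : Fin (n + 1) → ℕ → Ω → Plane} {H : Link n → Ω → ℝ}

lemma measurable_minAttenuation_loc (hM : p.IsModel μ X H) (i : Fin (n + 1)) :
    Measurable fun ω => p.minAttenuation i (fun j => X i j ω) :=
  (measurable_minAttenuation i).comp (measurable_pi_lambda _ fun j => hM.measurable_loc i j)

lemma measurableSet_attenuation_lt (i : Fin (n + 1)) (w : ℝ) :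
    MeasurableSet {x : Plane | p.attenuation i ‖x‖ < w} :=
  measurableSet_lt ((measurable_attenuation i).comp measurable_norm) measurable_const

lemma setOf_attenuation_lt_eq_ball (hp : p.Admissible) (i : Fin (n + 1)) {w : ℝ} (hw : 0 ≤ w) :
    {x : Plane | p.attenuation i ‖x‖ < w} = Metric.ball 0 (p.distOfAttenuation i w) := by
  ext x
  simp [hp.attenuation_lt_iff_lt_dist i hw (norm_nonneg x)]

namespace IsModel

/-- The part below level `θ` of the attenuations in a tier depends only on the points of attenuation
less than `θ`, so it is independent of the number of points in a set where the attenuation is at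
least `θ`. -/
lemma indepFun_min_pointCount_same [IsProbabilityMeasure μ] (hM : p.IsModel μ X H) (hp : p.Admissible)
    (i : Fin (n + 1))
    {θ : ℝ} {C : Set Plane} (hC : MeasurableSet C) (hCθ : ∀ x ∈ C, θ ≤ p.attenuation i ‖x‖) :
    IndepFun (fun ω => min (p.minAttenuation i (fun j => X i j ω)) θ) (pointCount (X i) C) μ := by
  have hm1 : Measurable fun ω => min (p.minAttenuation i (fun j => X i j ω)) θ :=
    (measurable_minAttenuation_loc hM i).min measurable_const
  have hm2 := measurable_pointCount (hM.ppp i).measurable hC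
  rw [IndepFun_iff_Indep]
  have hgen : MeasurableSpace.comap (fun ω => min (p.minAttenuation i (fun j => X i j ω)) θ)
      inferInstance = MeasurableSpace.generateFrom
        (Set.preimage (fun ω => min (p.minAttenuation i (fun j => X i j ω)) θ) ''
          Set.range Set.Ici) := by
    rw [← MeasurableSpace.comap_generateFrom, ← borel_eq_generateFrom_Ici,
      ← (BorelSpace.measurable_eq (α := ℝ))]
  refine IndepSets.indep hm1.comap_le hm2.comap_le (isPiSystem_Ici.comap _)
    (@MeasurableSpace.isPiSystem_measurableSet _ (MeasurableSpace.comap (pointCount (X i) C) _))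
    hgen (@MeasurableSpace.generateFrom_measurableSet _
      (MeasurableSpace.comap (pointCount (X i) C) _)).symm ?_
  rw [IndepSets_iff]
  rintro _ _ ⟨_, ⟨w, rfl⟩, rfl⟩ ⟨t, ht, rfl⟩
  by_cases hw : w ≤ θ
  · have e : (fun ω => min (p.minAttenuation i (fun j => X i j ω)) θ) ⁻¹' Set.Ici w =
        pointCount (X i) {x | p.attenuation i ‖x‖ < w} ⁻¹' {0} := by
      ext ω
      simp only [Set.mem_preimage, Set.mem_Ici, le_min_iff, hw, and_true, Set.mem_singleton_iff]
      exact hp.le_minAttenuation_iff_pointCount i ω w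
    have hdisj : Disjoint {x : Plane | p.attenuation i ‖x‖ < w} C :=
      Set.disjoint_left.2 fun x hx hxC => not_lt.2 (hw.trans (hCθ x hxC)) hx
    have hI := (hM.ppp i).indep 2 ![{x | p.attenuation i ‖x‖ < w}, C]
      (by
        intro l
        fin_cases l
        exacts [measurableSet_attenuation_lt i w, hC])
      (by
        intro l l' hl
        fin_cases l <;> fin_cases l'
        exacts [absurd rfl hl, hdisj, hdisj.symm, absurd rfl hl])
    rw [e]
    exact (hI.indepFun (show (0 : Fin 2) ≠ 1 by decide)).measure_inter_preimage_eq_mul _ _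
      (measurableSet_singleton 0) ht
  · have e : (fun ω => min (p.minAttenuation i (fun j => X i j ω)) θ) ⁻¹' Set.Ici w = ∅ := by
      ext ω
      simp only [Set.mem_preimage, Set.mem_Ici, le_min_iff, hw, and_false, Set.mem_empty_iff_false]
    simp [e]

/-- The attenuations below level `θ` in all the tiers together are independent of the number of
points of a tier in a set where the attenuation is at least `θ`. -/
lemma indepFun_min_pointCount [IsProbabilityMeasure μ] (hM : p.IsModel μ X H) (hp : p.Admissible)
    (i : Fin (n + 1))
    {θ : ℝ} {C : Set Plane} (hC : MeasurableSet C) (hCθ : ∀ x ∈ C, θ ≤ p.attenuation i ‖x‖) :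
    IndepFun (fun ω l => min (p.minAttenuation l (fun j => X l j ω)) θ)
      (pointCount (X i) C) μ := by
  have hm1 : Measurable fun ω l => min (p.minAttenuation l (fun j => X l j ω)) θ :=
    measurable_pi_lambda _ fun l => (measurable_minAttenuation_loc hM l).min measurable_const
  have hm2 := measurable_pointCount (hM.ppp i).measurable hC
  have hsame := hM.indepFun_min_pointCount_same hp i hC hCθ
  rw [IndepFun_iff_Indep]
  have hgen : MeasurableSpace.comap (fun ω l => min (p.minAttenuation l (fun j => X l j ω)) θ)
      inferInstance = MeasurableSpace.generateFrom
        (Set.preimage (fun ω l => min (p.minAttenuation l (fun j => X l j ω)) θ) ''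
          (Set.univ.pi '' Set.univ.pi fun _ : Fin (n + 1) => {s : Set ℝ | MeasurableSet s})) := by
    rw [← MeasurableSpace.comap_generateFrom, generateFrom_pi]
  refine IndepSets.indep hm1.comap_le hm2.comap_le (isPiSystem_pi.comap _)
    (@MeasurableSpace.isPiSystem_measurableSet _ (MeasurableSpace.comap (pointCount (X i) C) _))
    hgen (@MeasurableSpace.generateFrom_measurableSet _
      (MeasurableSpace.comap (pointCount (X i) C) _)).symm ?_
  rw [IndepSets_iff]
  rintro _ _ ⟨_, ⟨s, hs, rfl⟩, rfl⟩ ⟨t, ht, rfl⟩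
  have hs' : ∀ l, MeasurableSet (s l) := fun l => hs l (Set.mem_univ l)
  set A : Fin (n + 1) → Set Ω :=
    fun l => (fun ω => min (p.minAttenuation l (fun j => X l j ω)) θ) ⁻¹' s l with hA
  -- both kinds of events are functions of the location sequence of a single tier
  have hAm : ∀ l, MeasurableSet[MeasurableSpace.comap (fun ω j => X l j ω) inferInstance] (A l) :=
    fun l => ⟨(fun x : ℕ → Plane => min (p.minAttenuation l x) θ) ⁻¹' s l,
      ((measurable_minAttenuation l).min measurable_const) (hs' l), rfl⟩
  have hZm : MeasurableSet[MeasurableSpace.comap (fun ω j => X i j ω) inferInstance]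
      (pointCount (X i) C ⁻¹' t) :=
    ⟨pointCount (fun j (x : ℕ → Plane) => x j) C ⁻¹' t,
      measurable_pointCount (fun j => measurable_pi_apply j) hC ht, rfl⟩
  have e1 : (fun ω l => min (p.minAttenuation l (fun j => X l j ω)) θ) ⁻¹' (Set.univ.pi s) =
      ⋂ l, A l := by
    ext ω; simp [hA, Set.mem_pi]
  have e2 : (⋂ l, A l) ∩ pointCount (X i) C ⁻¹' t =
      ⋂ l, Function.update A i (A i ∩ pointCount (X i) C ⁻¹' t) l := by
    ext ω
    simp only [Set.mem_inter_iff, Set.mem_iInter]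
    constructor
    · rintro ⟨h1, h2⟩ l
      by_cases hl : l = i
      · subst hl; rw [Function.update_self]; exact ⟨h1 l, h2⟩
      · rw [Function.update_of_ne hl]; exact h1 l
    · intro h
      have hi := h i
      rw [Function.update_self] at hi
      refine ⟨fun l => ?_, hi.2⟩
      by_cases hl : l = i
      · subst hl; exact hi.1
      · have := h l
        rwa [Function.update_of_ne hl] at this
  have hprod : ∀ A' : Fin (n + 1) → Set Ω, ∏ l, μ (A' l) = μ (A' i) * ∏ l ∈ {i}ᶜ, μ (A' l) := by
    intro A'
    rw [← Finset.prod_mul_prod_compl {i}, Finset.prod_singleton]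
  rw [e1, e2, hM.indep_tiers.meas_iInter hAm, hM.indep_tiers.meas_iInter, hprod, hprod A,
    Function.update_self, hsame.measure_inter_preimage_eq_mul _ _ (hs' i) ht]
  · have : ∏ l ∈ {i}ᶜ, μ (Function.update A i (A i ∩ pointCount (X i) C ⁻¹' t) l)
        = ∏ l ∈ {i}ᶜ, μ (A l) := by
      refine Finset.prod_congr rfl fun l hl => ?_
      rw [Function.update_of_ne (by simpa using hl)]
    rw [this]
    ring
  · intro l
    by_cases hl : l = i
    · subst hl; rw [Function.update_self]; exact (hAm l).inter hZm
    · rw [Function.update_of_ne hl]; exact hAm l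

/-- On the event that the serving attenuation is below level `θ`, the points of attenuation at least
`θ` still have their unconditional mean numbers. -/
lemma tsum_measure_assoc_inter [IsProbabilityMeasure μ] (hM : p.IsModel μ X H) (hp : p.Admissible)
    (k i : Fin (n + 1))
    {θ : ℝ} {B : Set ℝ} (hB : MeasurableSet B)
    (hBθ : ∀ r ∈ B, 0 ≤ r → p.attenuation k r < θ)
    {C : Set Plane} (hC : MeasurableSet C) (hCv : volume C ≠ ∞)
    (hCθ : ∀ x ∈ C, θ ≤ p.attenuation i ‖x‖) :
    ∑' j, μ ((p.assoc X k ∩ p.servingDist X k ⁻¹' B) ∩ X i j ⁻¹' C) =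
      μ (p.assoc X k ∩ p.servingDist X k ⁻¹' B) * (ENNReal.ofReal (p.lam i) * volume C) := by
  have hX := hM.measurable_loc
  set G := p.assoc X k ∩ p.servingDist X k ⁻¹' B with hG
  have hGm : MeasurableSet G := (measurableSet_assoc hX k).inter (measurable_servingDist hX k hB)
  set Y : Ω → Fin (n + 1) → ℝ := fun ω l => min (p.minAttenuation l (fun j => X l j ω)) θ with hY
  have hYm : Measurable Y := measurable_pi_lambda _ fun l =>
    (measurable_minAttenuation_loc hM l).min measurable_const
  have hNm := measurable_pointCount (hM.ppp i).measurable hC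
  set D : Set (Fin (n + 1) → ℝ) := {y | (∀ l, y k ≤ y l) ∧ y k < θ ∧ p.distOfAttenuation k (y k) ∈ B}
    with hD
  have hDm : MeasurableSet D := by
    have h1 : MeasurableSet {y : Fin (n + 1) → ℝ | ∀ l, y k ≤ y l} := by
      have : {y : Fin (n + 1) → ℝ | ∀ l, y k ≤ y l} = ⋂ l, {y | y k ≤ y l} := by ext; simp
      rw [this]
      exact MeasurableSet.iInter fun l =>
        measurableSet_le (measurable_pi_apply k) (measurable_pi_apply l)
    have h2 : MeasurableSet {y : Fin (n + 1) → ℝ | y k < θ} :=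
      measurableSet_lt (measurable_pi_apply k) measurable_const
    have h3 : MeasurableSet {y : Fin (n + 1) → ℝ | p.distOfAttenuation k (y k) ∈ B} :=
      ((measurable_distOfAttenuation k).comp (measurable_pi_apply k)) hB
    exact h1.inter (h2.inter h3)
  have hGD : G =ᵐ[μ] Y ⁻¹' D := by
    filter_upwards [hM.ae_generic hp] with ω hg
    refine propext ?_
    change ω ∈ G ↔ Y ω ∈ D
    constructor
    · rintro ⟨h1, h2⟩
      have hlt : p.minAttenuation k (fun j => X k j ω) < θ := by
        rw [← hg.attenuation_servingDist hp h1]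
        exact hBθ _ h2 (norm_nonneg _)
      have hYk : Y ω k = p.minAttenuation k (fun j => X k j ω) := min_eq_left hlt.le
      refine ⟨fun l => ?_, hYk ▸ hlt, ?_⟩
      · rw [hYk]
        exact le_min ((hg.mem_assoc_iff hp k).1 h1 l) hlt.le
      · rw [hYk, ← hg.servingDist_eq hp h1]
        exact h2
    · rintro ⟨h1, h2, h3⟩
      have hYk : Y ω k = p.minAttenuation k (fun j => X k j ω) :=
        min_eq_left (le_of_lt ((min_lt_iff.1 h2).resolve_right (lt_irrefl θ)))
      have hA : ω ∈ p.assoc X k :=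
        (hg.mem_assoc_iff hp k).2 fun l => hYk ▸ (h1 l).trans (min_le_left _ _)
      refine ⟨hA, ?_⟩
      rw [Set.mem_preimage, hg.servingDist_eq hp hA, ← hYk]
      exact h3
  have hind := hM.indepFun_min_pointCount hp i hC hCθ
  have hsum : ∑' j, μ (G ∩ X i j ⁻¹' C) =
      ∫⁻ ω, (Y ⁻¹' D).indicator 1 ω * (pointCount (X i) C ω : ℝ≥0∞) ∂μ := by
    have h1 : ∀ j, μ (G ∩ X i j ⁻¹' C) =
        ∫⁻ ω, (Y ⁻¹' D).indicator 1 ω * C.indicator 1 (X i j ω) ∂μ := by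
      intro j
      rw [← lintegral_indicator_one (hGm.inter (hX i j hC))]
      refine lintegral_congr_ae ?_
      filter_upwards [hGD] with ω hω
      have hω' : ω ∈ G ↔ ω ∈ Y ⁻¹' D := Iff.of_eq hω
      by_cases h1 : ω ∈ Y ⁻¹' D <;> by_cases h2 : X i j ω ∈ C <;> simp [h1, h2, hω']
    simp_rw [h1, toENNReal_pointCount, ← ENNReal.tsum_mul_left]
    rw [lintegral_tsum]
    intro j
    exact ((measurable_one.indicator (hYm hDm)).mul
      ((measurable_one.indicator hC).comp (hX i j))).aemeasurable
  have hmul := lintegral_mul_eq_lintegral_mul_lintegral_of_indepFun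
    (μ := μ) (f := fun ω => (Y ⁻¹' D).indicator (1 : Ω → ℝ≥0∞) ω)
    (g := fun ω => (pointCount (X i) C ω : ℝ≥0∞))
    (measurable_one.indicator (hYm hDm)) ((measurable_of_countable _).comp hNm)
    (hind.comp (φ := D.indicator (1 : (Fin (n + 1) → ℝ) → ℝ≥0∞)) (ψ := fun m : ℕ∞ => (m : ℝ≥0∞))
      (measurable_one.indicator hDm) (measurable_of_countable _))
  rw [hsum]
  refine hmul.trans ?_
  rw [lintegral_indicator_one (hYm hDm), (hM.ppp i).lintegral_pointCount hC hCv,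
    measure_congr hGD]

/-- Campbell's formula relative to the serving base station: given the serving distance, the other
base stations of a tier contribute as those of a fresh Poisson process restricted to the region of
larger attenuation. -/
lemma campbell [IsProbabilityMeasure μ] (hM : p.IsModel μ X H) (hp : p.Admissible) (k i : Fin (n + 1))
    {f : ℝ → ℝ≥0∞} (hf : Measurable f) {φ : Plane → ℝ≥0∞} (hφ : Measurable φ) :
    ∑' j, ∫⁻ ω in p.assoc X k ∩ {ω | ¬ (i = k ∧ j = p.servingIdx X k ω)},
        f (p.servingDist X k ω) * φ (X i j ω) ∂μ =
      ∫⁻ ω in p.assoc X k, f (p.servingDist X k ω) * (ENNReal.ofReal (p.lam i) *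
        ∫⁻ x in {x | p.attenuation k (p.servingDist X k ω) < p.attenuation i ‖x‖}, φ x) ∂μ := by
  have hX := hM.measurable_loc
  have hRm := measurable_servingDist (p := p) hX k
  have hAm := measurableSet_assoc (p := p) hX k
  set G : ℕ → Set Ω := fun j => p.assoc X k ∩ {ω | ¬ (i = k ∧ j = p.servingIdx X k ω)} with hG
  have hGm : ∀ j, MeasurableSet (G j) := measurableSet_assoc_not_serving hX k i
  have hRX : ∀ j, Measurable fun ω => (p.servingDist X k ω, X i j ω) := fun j => hRm.prodMk (hX i j)
  set m1 : Measure (ℝ × Plane) := Measure.sum fun j =>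
    (μ.restrict (G j)).map fun ω => (p.servingDist X k ω, X i j ω) with hm1
  set ν : Measure (ℝ × Plane) := ((μ.restrict (p.assoc X k)).map (p.servingDist X k)).prod
    (ENNReal.ofReal (p.lam i) • volume) with hν
  set U : Set (ℝ × Plane) := {q | 0 < q.1 ∧ p.attenuation k q.1 < p.attenuation i ‖q.2‖} with hU
  have hatt1 : Measurable fun q : ℝ × Plane => p.attenuation k q.1 :=
    (measurable_attenuation k).comp measurable_fst
  have hatt2 : Measurable fun q : ℝ × Plane => p.attenuation i ‖q.2‖ :=
    (measurable_attenuation i).comp measurable_snd.norm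
  have hUm : MeasurableSet U :=
    (measurableSet_lt measurable_const measurable_fst).inter (measurableSet_lt hatt1 hatt2)
  -- the region `U` is a countable union of bounded rectangles
  let B : ℚ × ℕ → Set ℝ := fun t => {r | 0 < r ∧ p.attenuation k r < t.1}
  let C : ℚ × ℕ → Set Plane := fun t => {x | (t.1 : ℝ) ≤ p.attenuation i ‖x‖ ∧ ‖x‖ < t.2}
  have hBm : ∀ t, MeasurableSet (B t) := fun t =>
    (measurableSet_lt measurable_const measurable_id).inter
      (measurableSet_lt (measurable_attenuation k) measurable_const)
  have hCm : ∀ t, MeasurableSet (C t) := fun t =>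
    (measurableSet_le measurable_const ((measurable_attenuation i).comp measurable_norm)).inter
      (measurableSet_lt measurable_norm measurable_const)
  have hUeq : U = ⋃ t, B t ×ˢ C t := by
    ext ⟨r, x⟩
    simp only [Set.mem_iUnion, Set.mem_prod]
    constructor
    · rintro ⟨h1, h2⟩
      obtain ⟨q, hq1, hq2⟩ := exists_rat_btwn h2
      obtain ⟨m, hm⟩ := exists_nat_gt ‖x‖
      exact ⟨(q, m), ⟨h1, hq1⟩, hq2.le, hm⟩
    · rintro ⟨t, ⟨h1, h2⟩, h3, -⟩
      exact ⟨h1, h2.trans_le h3⟩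
  have hrect : ∀ t, m1.restrict (B t ×ˢ C t) = ν.restrict (B t ×ˢ C t) := by
    intro t
    have hfin : volume (C t) ≠ ∞ := by
      refine ((measure_mono (t := Metric.ball 0 t.2) fun x hx => ?_).trans_lt
        measure_ball_lt_top).ne
      simpa using hx.2
    have : IsFiniteMeasure ((ENNReal.ofReal (p.lam i) • volume : Measure Plane).restrict (C t)) :=
      ⟨by simpa using ENNReal.mul_lt_top ENNReal.ofReal_lt_top hfin.lt_top⟩
    rw [hν, ← Measure.prod_restrict]
    symm
    refine Measure.prod_eq fun s s' hs hs' => ?_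
    rw [Measure.restrict_apply (hs.prod hs'), Set.prod_inter_prod, hm1,
      Measure.sum_apply _ ((hs.inter (hBm t)).prod (hs'.inter (hCm t))),
      Measure.restrict_apply hs, Measure.restrict_apply hs',
      Measure.map_apply hRm (hs.inter (hBm t)),
      Measure.restrict_apply (hRm (hs.inter (hBm t))), Measure.smul_apply, smul_eq_mul]
    have := hM.tsum_measure_assoc_inter hp k i (θ := t.1) (hs.inter (hBm t))
      (fun r hr _ => hr.2.2) (hs'.inter (hCm t))
      (ne_top_of_le_ne_top hfin (measure_mono Set.inter_subset_right)) (fun x hx => hx.2.1)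
    rw [Set.inter_comm (p.servingDist X k ⁻¹' _), ← this]
    refine tsum_congr fun j => ?_
    rw [Measure.map_apply (hRX j) ((hs.inter (hBm t)).prod (hs'.inter (hCm t))),
      Measure.restrict_apply (hRX j ((hs.inter (hBm t)).prod (hs'.inter (hCm t))))]
    congr 1
    ext ω
    constructor
    · rintro ⟨⟨h1, h2⟩, h3, -⟩
      exact ⟨⟨h3, h1⟩, h2⟩
    · rintro ⟨⟨h3, h1⟩, h2⟩
      refine ⟨⟨h1, h2⟩, h3, ?_⟩
      rintro ⟨rfl, rfl⟩
      exact absurd (h1.2.2.trans_le h2.2.1) (lt_irrefl _)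
  have hUeqm : m1.restrict U = ν.restrict U := by
    rw [hUeq]
    exact Measure.restrict_iUnion_congr.2 hrect
  have hserv : ∀ᵐ ω ∂μ, ω ∈ p.assoc X k → 0 < p.servingDist X k ω := by
    filter_upwards [hM.ae_generic hp] with ω hg _ using hg.norm_pos _ _
  have hm1U : m1.restrict U = m1 := by
    refine Measure.restrict_eq_self_of_ae_mem ?_
    rw [hm1]
    refine (Measure.ae_sum_iff' (show MeasurableSet {q | q ∈ U} from hUm)).2 fun j => ?_
    refine (ae_map_iff (hRX j).aemeasurable hUm).2 ?_
    refine (ae_restrict_iff' (hGm j)).2 ?_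
    filter_upwards [hM.ae_generic hp] with ω hg hω
    exact ⟨hg.norm_pos _ _, hg.attenuation_servingDist_lt hp hω.1 hω.2⟩
  have hFm : Measurable fun q : ℝ × Plane => f q.1 * φ q.2 :=
    (hf.comp measurable_fst).mul (hφ.comp measurable_snd)
  calc ∑' j, ∫⁻ ω in G j, f (p.servingDist X k ω) * φ (X i j ω) ∂μ
      = ∫⁻ q, f q.1 * φ q.2 ∂m1 := by
        rw [hm1, lintegral_sum_measure]
        refine tsum_congr fun j => ?_
        rw [lintegral_map hFm (hRX j)]
    _ = ∫⁻ q, U.indicator (fun q => f q.1 * φ q.2) q ∂ν := by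
        rw [← hm1U, hUeqm, lintegral_indicator hUm]
    _ = ∫⁻ ω in p.assoc X k, ∫⁻ x, U.indicator (fun q => f q.1 * φ q.2) (p.servingDist X k ω, x)
          ∂(ENNReal.ofReal (p.lam i) • volume) ∂μ := by
        rw [hν, lintegral_prod _ (hFm.indicator hUm).aemeasurable, lintegral_map ?_ hRm]
        exact (hFm.indicator hUm).lintegral_prod_right'
    _ = _ := by
        refine setLIntegral_congr_fun_ae hAm ?_
        filter_upwards [hserv] with ω hω hA
        have hS : MeasurableSet {x : Plane |
            p.attenuation k (p.servingDist X k ω) < p.attenuation i ‖x‖} :=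
          measurableSet_lt measurable_const ((measurable_attenuation i).comp measurable_norm)
        rw [lintegral_smul_measure, smul_eq_mul, mul_left_comm, ← lintegral_const_mul _ hφ,
          ← lintegral_indicator hS]
        congr 1
        refine lintegral_congr fun x => ?_
        by_cases hx : p.attenuation k (p.servingDist X k ω) < p.attenuation i ‖x‖
        · rw [Set.indicator_of_mem (show _ ∈ U from ⟨hω hA, hx⟩),
            Set.indicator_of_mem (by exact hx)]
        · rw [Set.indicator_of_notMem (fun h => hx h.2), Set.indicator_of_notMem (by exact hx)]

lemma measure_le_minAttenuation (hM : p.IsModel μ X H) (hp : p.Admissible) (i : Fin (n + 1))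
    {w : ℝ} (hw : 0 ≤ w) : μ {ω | w ≤ p.minAttenuation i (fun j => X i j ω)} =
      ENNReal.ofReal (Real.exp (-(p.lam i * (Real.pi * p.distOfAttenuation i w ^ 2)))) := by
  simp_rw [hp.le_minAttenuation_iff_pointCount]
  have hv := volume_ball_plane 0 (hp.distOfAttenuation_nonneg i hw)
  rw [setOf_attenuation_lt_eq_ball hp i hw,
    (hM.ppp i).measure_void (hp.lam_pos i).le measurableSet_ball measure_ball_lt_top.ne, hv,
    ENNReal.toReal_ofReal (by positivity)]

/-- The serving base station belongs to tier `k` at a distance in `[a, b)` with positive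
probability. -/
lemma measure_assoc_inter_ne_zero [IsProbabilityMeasure μ] (hM : p.IsModel μ X H) (hp : p.Admissible)
    (k : Fin (n + 1))
    {a b : ℝ} (ha : 0 ≤ a) (hab : a < b) :
    μ (p.assoc X k ∩ p.servingDist X k ⁻¹' Set.Ico a b) ≠ 0 := by
  have hb : 0 ≤ b := ha.trans hab.le
  set u := p.attenuation k a with hu
  set v := p.attenuation k b with hv
  have hu0 : 0 ≤ u := hp.attenuation_nonneg k ha
  have hv0 : 0 ≤ v := hp.attenuation_nonneg k hb
  have huv : u < v := (hp.attenuation_lt_iff k ha hb).2 hab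
  set A : Fin (n + 1) → Set Ω := fun l =>
    (fun ω => p.minAttenuation l (fun j => X l j ω)) ⁻¹' (if l = k then Set.Ico u v else Set.Ici v)
    with hA
  have hAm : ∀ l, MeasurableSet[MeasurableSpace.comap (fun ω j => X l j ω) inferInstance] (A l) :=
    fun l => ⟨p.minAttenuation l ⁻¹' (if l = k then Set.Ico u v else Set.Ici v),
      (measurable_minAttenuation l) (by split_ifs; exacts [measurableSet_Ico, measurableSet_Ici]),
      rfl⟩
  have hsub : (⋂ l, A l : Set Ω) ≤ᵐ[μ] (p.assoc X k ∩ p.servingDist X k ⁻¹' Set.Ico a b : Set Ω) := by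
    filter_upwards [hM.ae_generic hp] with ω hg hω
    have hω' : ∀ l, ω ∈ A l := Set.mem_iInter.1 hω
    have hk : p.minAttenuation k (fun j => X k j ω) ∈ Set.Ico u v := by
      have := hω' k
      simpa only [hA, if_true, Set.mem_preimage] using this
    have hassoc : ω ∈ p.assoc X k := by
      refine (hg.mem_assoc_iff hp k).2 fun l => ?_
      by_cases hl : l = k
      · rw [hl]
      · have := hω' l
        simp only [hA, if_neg hl, Set.mem_preimage, Set.mem_Ici] at this
        exact hk.2.le.trans this
    refine ⟨hassoc, ?_⟩
    rw [← hg.attenuation_servingDist hp hassoc] at hk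
    exact ⟨(hp.attenuation_le_iff k ha (norm_nonneg _)).1 hk.1,
      (hp.attenuation_lt_iff k (norm_nonneg _) hb).1 hk.2⟩
  refine fun h0 => absurd (le_antisymm ((measure_mono_ae hsub).trans h0.le) zero_le) ?_
  rw [hM.indep_tiers.meas_iInter hAm]
  refine Finset.prod_ne_zero_iff.2 fun l _ => ?_
  by_cases hl : l = k
  · subst hl
    have e : A l = {ω | u ≤ p.minAttenuation l (fun j => X l j ω)} \
        {ω | v ≤ p.minAttenuation l (fun j => X l j ω)} := by
      ext ω; simp [hA]
    have hm := measurable_minAttenuation_loc hM l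
    have hsub' : {ω | v ≤ p.minAttenuation l (fun j => X l j ω)} ⊆
        {ω | u ≤ p.minAttenuation l (fun j => X l j ω)} := fun ω hω => huv.le.trans hω
    rw [e, measure_sdiff hsub' (measurableSet_le measurable_const hm).nullMeasurableSet (measure_ne_top _ _),
      hM.measure_le_minAttenuation hp l hu0, hM.measure_le_minAttenuation hp l hv0,
      hu, hv, hp.distOfAttenuation_attenuation l ha, hp.distOfAttenuation_attenuation l hb]
    refine (tsub_pos_of_lt ?_).ne'
    rw [ENNReal.ofReal_lt_ofReal_iff (Real.exp_pos _), Real.exp_lt_exp, neg_lt_neg_iff]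
    have := hp.lam_pos l
    gcongr
  · have e : A l = {ω | v ≤ p.minAttenuation l (fun j => X l j ω)} := by
      ext ω; simp [hA, hl]
    rw [e, hM.measure_le_minAttenuation hp l hv0]
    simp [Real.exp_pos]

end IsModel

end HetNet

/-! ### Conditional means and their disintegration -/

/-- `T` and `t (R)` have the same integral over every event `A ∩ {R ∈ B}`. This is the conditional
mean of `T` given `A` and `R` in unnormalized form, which is linear in `T`. -/
structure HasCondMean {Ω : Type*} [MeasurableSpace Ω] (μ : Measure Ω) (A : Set Ω) (R T : Ω → ℝ)
    (t : ℝ → ℝ) : Prop where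
  integrable : IntegrableOn T A μ
  integrable_comp : IntegrableOn (fun ω => t (R ω)) A μ
  setIntegral_eq : ∀ B : Set ℝ, MeasurableSet B →
    ∫ ω in A ∩ R ⁻¹' B, T ω ∂μ = ∫ ω in A ∩ R ⁻¹' B, t (R ω) ∂μ

namespace HasCondMean

variable {Ω : Type*} [MeasurableSpace Ω] {μ : Measure Ω} {A : Set Ω} {R T T' : Ω → ℝ}
  {t t' : ℝ → ℝ}

lemma add (h : HasCondMean μ A R T t) (h' : HasCondMean μ A R T' t') :
    HasCondMean μ A R (fun ω => T ω + T' ω) (fun x => t x + t' x) where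
  integrable := h.integrable.add h'.integrable
  integrable_comp := h.integrable_comp.add h'.integrable_comp
  setIntegral_eq B hB := by
    rw [integral_add (h.integrable.mono_set Set.inter_subset_left)
        (h'.integrable.mono_set Set.inter_subset_left),
      integral_add (h.integrable_comp.mono_set Set.inter_subset_left)
        (h'.integrable_comp.mono_set Set.inter_subset_left),
      h.setIntegral_eq B hB, h'.setIntegral_eq B hB]

lemma const_mul (c : ℝ) (h : HasCondMean μ A R T t) :
    HasCondMean μ A R (fun ω => c * T ω) (fun x => c * t x) where
  integrable := h.integrable.const_mul c
  integrable_comp := h.integrable_comp.const_mul c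
  setIntegral_eq B hB := by
    rw [integral_const_mul, integral_const_mul, h.setIntegral_eq B hB]

lemma sum {ι : Type*} (s : Finset ι) {T : ι → Ω → ℝ} {t : ι → ℝ → ℝ}
    (h : ∀ i ∈ s, HasCondMean μ A R (T i) (t i)) :
    HasCondMean μ A R (fun ω => ∑ i ∈ s, T i ω) (fun x => ∑ i ∈ s, t i x) where
  integrable := integrable_finsetSum s fun i hi => (h i hi).integrable
  integrable_comp := integrable_finsetSum s fun i hi => (h i hi).integrable_comp
  setIntegral_eq B hB := by
    rw [integral_finsetSum s fun i hi => (h i hi).integrable.mono_set Set.inter_subset_left,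
      integral_finsetSum s fun i hi => (h i hi).integrable_comp.mono_set Set.inter_subset_left]
    exact Finset.sum_congr rfl fun i hi => (h i hi).setIntegral_eq B hB

/-- For nonnegative quantities the lower integrals suffice. -/
lemma of_lintegral (hA : MeasurableSet A) (hR : Measurable R) (hT : AEMeasurable T μ)
    (hT0 : ∀ᵐ ω ∂μ, ω ∈ A → 0 ≤ T ω) (ht : Measurable t) (ht0 : ∀ ω, 0 ≤ t (R ω))
    (hfin : ∫⁻ ω in A, ENNReal.ofReal (t (R ω)) ∂μ ≠ ∞)
    (h : ∀ B : Set ℝ, MeasurableSet B → ∫⁻ ω in A ∩ R ⁻¹' B, ENNReal.ofReal (T ω) ∂μ =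
      ∫⁻ ω in A ∩ R ⁻¹' B, ENNReal.ofReal (t (R ω)) ∂μ) :
    HasCondMean μ A R T t where
  integrable := by
    have h0 : 0 ≤ᵐ[μ.restrict A] T := (ae_restrict_iff' hA).2 hT0
    refine ⟨hT.aestronglyMeasurable.restrict, ?_⟩
    rw [hasFiniteIntegral_iff_ofReal h0]
    have := h Set.univ MeasurableSet.univ
    rw [Set.preimage_univ, Set.inter_univ] at this
    rw [this]
    exact hfin.lt_top
  integrable_comp := by
    refine ⟨(ht.comp hR).aestronglyMeasurable, ?_⟩
    rw [hasFiniteIntegral_iff_ofReal (ae_of_all _ ht0)]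
    exact hfin.lt_top
  setIntegral_eq B hB := by
    rw [integral_eq_lintegral_of_nonneg_ae _ hT.aestronglyMeasurable.restrict,
      integral_eq_lintegral_of_nonneg_ae (ae_of_all _ ht0) (ht.comp hR).aestronglyMeasurable,
      h B hB]
    refine (ae_restrict_iff' (hA.inter (hR hB))).2 ?_
    filter_upwards [hT0] with ω hω hmem using hω hmem.1

/-- Continuity of the mean in the value of `R` turns integrals over windows into the pointwise limit
that `IsCondMean` asks for. -/
lemma isCondMean [IsProbabilityMeasure μ] (h : HasCondMean μ A R T t) (hA : MeasurableSet A)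
    (hR : Measurable R) (hRpos : ∀ᵐ ω ∂μ, ω ∈ A → 0 < R ω) (ht : Continuous t) {g : ℝ → ℝ}
    (hg : ∀ x, 0 < x → g x = t x)
    (hpos : ∀ x : ℝ, 0 < x → ∀ ε : ℝ, 0 < ε → μ (A ∩ {ω | |R ω - x| ≤ ε}) ≠ 0) :
    IsCondMean μ A R T g := by
  have hA0 : μ A ≠ 0 := fun h0 =>
    hpos 1 one_pos 1 one_pos (measure_mono_null Set.inter_subset_left h0)
  have hAprob : IsProbabilityMeasure (cond μ A) := cond_isProbabilityMeasure hA0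
  have hinv : (μ A)⁻¹ ≠ ∞ := ENNReal.inv_ne_top.2 hA0
  have hint : Integrable T (cond μ A) := h.integrable.smul_measure hinv
  have hint' : Integrable (fun ω => t (R ω)) (cond μ A) := h.integrable_comp.smul_measure hinv
  have hset : ∀ (f : Ω → ℝ) (B : Set ℝ), MeasurableSet B → ∫ ω in R ⁻¹' B, f ω ∂(cond μ A) =
      (μ A)⁻¹.toReal • ∫ ω in A ∩ R ⁻¹' B, f ω ∂μ := by
    intro f B hB
    rw [ProbabilityTheory.cond, Measure.restrict_smul, Measure.restrict_restrict (hR hB), integral_smul_measure,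
      Set.inter_comm]
  refine ⟨hA0, hR, hint, ?_, hpos, ?_⟩
  · have h1 : (fun ω => t (R ω)) =ᵐ[cond μ A]
        condExp (MeasurableSpace.comap R inferInstance) (cond μ A) T := by
      refine ae_eq_condExp_of_forall_setIntegral_eq hR.comap_le hint
        (fun s _ _ => hint'.integrableOn) ?_ ?_
      · rintro _ ⟨B, hB, rfl⟩ -
        rw [hset _ B hB, hset _ B hB, h.setIntegral_eq B hB]
      · exact (ht.measurable.comp (comap_measurable R)).stronglyMeasurable.aestronglyMeasurable
    have h2 : ∀ᵐ ω ∂(cond μ A), t (R ω) = g (R ω) := by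
      filter_upwards [ae_cond_mem hA, cond_absolutelyContinuous.ae_le hRpos] with ω h3 h4
      exact (hg _ (h4 h3)).symm
    exact h1.symm.trans h2
  · intro x hx
    rw [hg x hx, Metric.tendsto_nhds]
    intro e he
    obtain ⟨δ, hδ, hcont⟩ := Metric.continuous_iff.1 ht x (e / 2) (half_pos he)
    have hev : ∀ᶠ ε in 𝓝[>] (0 : ℝ), ε < δ := nhdsWithin_le_nhds (eventually_lt_nhds hδ)
    filter_upwards [hev, self_mem_nhdsWithin] with ε hε hε0
    have hB : MeasurableSet (Metric.closedBall x ε) := measurableSet_closedBall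
    have hWeq : {ω | |R ω - x| ≤ ε} = R ⁻¹' Metric.closedBall x ε := by
      ext ω; simp [Real.dist_eq]
    have hW0 := hpos x hx ε hε0
    rw [hWeq] at hW0 ⊢
    have hWprob : IsProbabilityMeasure (cond μ (A ∩ R ⁻¹' Metric.closedBall x ε)) :=
      cond_isProbabilityMeasure hW0
    have e1 : ∫ ω, T ω ∂(cond μ (A ∩ R ⁻¹' Metric.closedBall x ε)) =
        ∫ ω, t (R ω) ∂(cond μ (A ∩ R ⁻¹' Metric.closedBall x ε)) := by
      rw [ProbabilityTheory.cond, integral_smul_measure, integral_smul_measure, h.setIntegral_eq _ hB]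
    have hintW : Integrable (fun ω => t (R ω)) (cond μ (A ∩ R ⁻¹' Metric.closedBall x ε)) :=
      (h.integrable_comp.mono_set Set.inter_subset_left).smul_measure (ENNReal.inv_ne_top.2 hW0)
    have e2 : ∫ ω, t (R ω) ∂(cond μ (A ∩ R ⁻¹' Metric.closedBall x ε)) - t x =
        ∫ ω, (t (R ω) - t x) ∂(cond μ (A ∩ R ⁻¹' Metric.closedBall x ε)) := by
      rw [integral_sub hintW (integrable_const _), integral_const]
      simp
    rw [e1, Real.dist_eq, e2, ← Real.norm_eq_abs]
    refine lt_of_le_of_lt (norm_integral_le_of_norm_le_const (C := e / 2) ?_) ?_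
    · filter_upwards [ae_cond_mem (hA.inter (hR hB))] with ω hω
      rw [← dist_eq_norm]
      exact (hcont _ ((Metric.mem_closedBall.1 hω.2).trans_lt hε)).le
    · simpa using he

end HasCondMean

/-! ### Fading, interference and the serving link -/

namespace HetNet

variable {n : ℕ} {Ω : Type*} {p : HetNet n} {X : Fin (n + 1) → ℕ → Ω → Plane}
  {H : Link n → Ω → ℝ}

/-- The mean of the fading gain of a link. -/
noncomputable def meanFading (p : HetNet n) : Link n → ℝ
  | .directed => p.N
  | .shared => 1
  | .small => 1
  | .ambient _ _ => 1

/-- The distance beyond which a base station of tier `i` does not beat a base station of tier `k` at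
distance `x`. -/
noncomputable def exclusionRadius (p : HetNet n) (k i : Fin (n + 1)) (x : ℝ) : ℝ :=
  p.distOfAttenuation i (p.attenuation k x)

/-- The conditional mean of the interference from tier `i`, given that the serving base station
belongs to tier `k` and is at distance `x`. -/
noncomputable def meanInterference (p : HetNet n) (k i : Fin (n + 1)) (x : ℝ) : ℝ :=
  p.P i * p.β * (p.lam i * (2 * Real.pi * radialTail (p.α i) p.d (p.exclusionRadius k i x)))

/-- The power received on average from a base station of tier `i` located at `x`, when it is not the
serving one. -/
noncomputable def truncatedPower (p : HetNet n) (i : Fin (n + 1)) (x : Plane) : ℝ :=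
  p.P i * p.pathLoss i (max ‖x‖ p.d)

lemma Admissible.max_d_pos (hp : p.Admissible) (r : ℝ) : 0 < max r p.d :=
  hp.d_pos.trans_le (le_max_right _ _)

lemma Admissible.pathLoss_max_pos (hp : p.Admissible) (i : Fin (n + 1)) (r : ℝ) :
    0 < p.pathLoss i (max r p.d) :=
  mul_pos hp.β_pos (Real.rpow_pos_of_pos (hp.max_d_pos r) _)

lemma Admissible.truncatedPower_nonneg (hp : p.Admissible) (i : Fin (n + 1)) (x : Plane) :
    0 ≤ p.truncatedPower i x :=
  (mul_pos (hp.P_pos i) (hp.pathLoss_max_pos i _)).le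

lemma Admissible.continuous_pathLoss_max (hp : p.Admissible) (i : Fin (n + 1)) :
    Continuous fun r => p.pathLoss i (max r p.d) :=
  continuous_const.mul ((continuous_id.max continuous_const).rpow_const
    fun r => Or.inl (hp.max_d_pos r).ne')

lemma Admissible.measurable_truncatedPower (hp : p.Admissible) (i : Fin (n + 1)) :
    Measurable (p.truncatedPower i) :=
  ((hp.continuous_pathLoss_max i).measurable.comp measurable_norm).const_mul _

lemma Admissible.exclusionRadius_nonneg (hp : p.Admissible) (k i : Fin (n + 1)) {x : ℝ}
    (hx : 0 ≤ x) : 0 ≤ p.exclusionRadius k i x :=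
  hp.distOfAttenuation_nonneg i (hp.attenuation_nonneg k hx)

lemma Admissible.continuous_meanInterference (hp : p.Admissible) (k i : Fin (n + 1)) :
    Continuous (p.meanInterference k i) := by
  have h1 : Continuous (p.attenuation k) :=
    (continuous_id.rpow_const fun _ => Or.inr (hp.α_pos k).le).div_const _
  have h2 : Continuous (p.distOfAttenuation i) :=
    (continuous_id.const_mul _).rpow_const fun _ => Or.inr (one_div_pos.2 (hp.α_pos i)).le
  have h3 : Continuous (p.exclusionRadius k i) := h2.comp h1
  exact (((continuous_radialTail (p.α i) hp.d_pos).comp h3).const_mul _ |>.const_mul _).const_mul _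

lemma Admissible.meanInterference_nonneg (hp : p.Admissible) (k i : Fin (n + 1)) {x : ℝ}
    (hx : 0 ≤ x) : 0 ≤ p.meanInterference k i x := by
  have h1 := hp.P_pos i
  have h2 := hp.β_pos
  have h3 := hp.lam_pos i
  have h4 := radialTail_nonneg (hp.α_gt i) hp.d_pos (hp.exclusionRadius_nonneg k i hx)
  unfold meanInterference
  positivity

lemma Admissible.lintegral_truncatedPower (hp : p.Admissible) (i : Fin (n + 1)) {ρ : ℝ}
    (hρ : 0 ≤ ρ) : ∫⁻ x in {x : Plane | ρ < ‖x‖}, ENNReal.ofReal (p.truncatedPower i x) =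
      ENNReal.ofReal (p.P i * p.β * (2 * Real.pi * radialTail (p.α i) p.d ρ)) := by
  have h : 0 ≤ p.P i * p.β := (mul_pos (hp.P_pos i) hp.β_pos).le
  have hm : Measurable fun x : Plane => ENNReal.ofReal (max ‖x‖ p.d ^ (-p.α i)) :=
    ((measurable_norm.max measurable_const).pow_const _).ennreal_ofReal
  rw [ENNReal.ofReal_mul h, ← lintegral_max_norm_rpow (hp.α_gt i) hp.d_pos hρ,
    ← lintegral_const_mul _ hm]
  refine lintegral_congr fun x => ?_
  rw [← ENNReal.ofReal_mul h, truncatedPower, pathLoss, mul_assoc]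

lemma Admissible.lintegral_truncatedPower_lt_attenuation (hp : p.Admissible)
    (k i : Fin (n + 1)) {r : ℝ} (hr : 0 ≤ r) : ENNReal.ofReal (p.lam i) *
      ∫⁻ x in {x | p.attenuation k r < p.attenuation i ‖x‖}, ENNReal.ofReal (p.truncatedPower i x) =
      ENNReal.ofReal (p.meanInterference k i r) := by
  have : {x : Plane | p.attenuation k r < p.attenuation i ‖x‖} =
      {x | p.exclusionRadius k i r < ‖x‖} := by
    ext x
    exact hp.lt_attenuation_iff i (hp.attenuation_nonneg k hr) (norm_nonneg x)
  rw [this, hp.lintegral_truncatedPower i (hp.exclusionRadius_nonneg k i hr),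
    ← ENNReal.ofReal_mul (hp.lam_pos i).le, meanInterference]
  congr 1
  ring

lemma Admissible.lintegral_truncatedPower_lt_top (hp : p.Admissible) (i : Fin (n + 1)) :
    ∫⁻ x, ENNReal.ofReal (p.truncatedPower i x) < ∞ := by
  have h := hp.lintegral_truncatedPower i le_rfl
  have : {x : Plane | 0 < ‖x‖} =ᵐ[volume] Set.univ := by
    have h0 : {x : Plane | 0 < ‖x‖} = {0}ᶜ := by ext x; simp
    rw [h0]
    exact compl_mem_ae_iff.2 (measure_singleton _) |> eventuallyEq_univ.2
  rw [setLIntegral_congr this, setLIntegral_univ] at h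
  rw [h]
  exact ENNReal.ofReal_lt_top

lemma ambientPower_eq (i : Fin (n + 1)) (j : ℕ) (ω : Ω) :
    p.ambientPower X H i j ω = H (.ambient i j) ω * p.truncatedPower i (X i j ω) := by
  rw [ambientPower, truncatedPower]; ring

variable [MeasurableSpace Ω] {μ : Measure Ω}

lemma ae_nonneg_fading (hM : p.IsModel μ X H) : ∀ᵐ ω ∂μ, ∀ l, 0 ≤ H l ω := by
  have : Countable (Link n) := by
    have hinj : Function.Injective (fun l : Link n => match l with
        | .directed => Sum.inl (0 : Fin 3)
        | .shared => Sum.inl 1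
        | .small => Sum.inl 2
        | .ambient i j => Sum.inr (i, j) : Link n → Fin 3 ⊕ (Fin (n + 1) × ℕ)) := by
      intro l l' h
      cases l <;> cases l' <;> simp_all
    exact hinj.countable
  rw [ae_all_iff]
  intro l
  refine ae_of_ae_map (hM.measurable_fading l).aemeasurable (p := fun x => 0 ≤ x) ?_
  rw [hM.law_fading l]
  cases l <;> exact ae_nonneg_gammaMeasure _ _

lemma lintegral_fading (hM : p.IsModel μ X H) (hp : p.Admissible) (l : Link n) :
    ∫⁻ ω, ENNReal.ofReal (H l ω) ∂μ = ENNReal.ofReal (p.meanFading l) := by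
  rw [← lintegral_map ENNReal.measurable_ofReal (hM.measurable_fading l), hM.law_fading l]
  cases l
  · exact lintegral_ofReal_gammaMeasure (by exact_mod_cast hp.N_pos)
  all_goals exact lintegral_ofReal_gammaMeasure one_pos

lemma meanFading_nonneg (l : Link n) : 0 ≤ p.meanFading l := by
  cases l <;> simp [meanFading]

/-- Fading gains may be averaged out of any expression in the base station locations. -/
lemma lintegral_fading_mul (hM : p.IsModel μ X H) (hp : p.Admissible) (l : Link n)
    {F : (Fin (n + 1) → ℕ → Plane) → ℝ≥0∞} (hF : Measurable F) :
    ∫⁻ ω, ENNReal.ofReal (H l ω) * F (fun i j => X i j ω) ∂μ =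
      ENNReal.ofReal (p.meanFading l) * ∫⁻ ω, F (fun i j => X i j ω) ∂μ := by
  rw [← lintegral_fading hM hp l]
  have hX : Measurable fun (ω : Ω) (i : Fin (n + 1)) (j : ℕ) => X i j ω :=
    measurable_pi_lambda _ fun i => measurable_pi_lambda _ fun j => hM.measurable_loc i j
  exact lintegral_mul_eq_lintegral_mul_lintegral_of_indepFun
    (hM.measurable_fading l).ennreal_ofReal (hF.comp hX)
    (hM.indep_fading_loc.comp (φ := fun h : Link n → ℝ => ENNReal.ofReal (h l)) (ψ := F)
      (measurable_pi_apply l).ennreal_ofReal hF)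

/-- The location processes on the space of configurations, on which `assoc`, `servingIdx` and
`servingDist` can be evaluated to see that they are measurable functions of the locations. -/
def coordLoc (n : ℕ) : Fin (n + 1) → ℕ → (Fin (n + 1) → ℕ → Plane) → Plane :=
  fun i j z => z i j

lemma measurable_coordLoc (i : Fin (n + 1)) (j : ℕ) : Measurable (coordLoc n i j) :=
  (measurable_pi_apply j).comp (measurable_pi_apply i)

lemma measurable_ambientPower (hM : p.IsModel μ X H) (hp : p.Admissible) (i : Fin (n + 1))
    (j : ℕ) : Measurable (p.ambientPower X H i j) := by
  have : p.ambientPower X H i j = fun ω => H (.ambient i j) ω * p.truncatedPower i (X i j ω) :=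
    funext fun ω => ambientPower_eq i j ω
  rw [this]
  exact (hM.measurable_fading _).mul ((hp.measurable_truncatedPower i).comp (hM.measurable_loc i j))

variable [IsProbabilityMeasure μ]

lemma ae_summable_ambientPower (hM : p.IsModel μ X H) (hp : p.Admissible) :
    ∀ᵐ ω ∂μ, ∀ i, Summable fun j => p.ambientPower X H i j ω := by
  rw [ae_all_iff]
  intro i
  have hφ : Measurable fun x => ENNReal.ofReal (p.truncatedPower i x) :=
    (hp.measurable_truncatedPower i).ennreal_ofReal
  have hfin : ∫⁻ ω, ∑' j, ENNReal.ofReal (p.ambientPower X H i j ω) ∂μ ≠ ∞ := by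
    rw [lintegral_tsum fun j => (measurable_ambientPower hM hp i j).ennreal_ofReal.aemeasurable]
    have : ∀ j, ∫⁻ ω, ENNReal.ofReal (p.ambientPower X H i j ω) ∂μ =
        ∫⁻ ω, ENNReal.ofReal (p.truncatedPower i (X i j ω)) ∂μ := by
      intro j
      have := lintegral_fading_mul hM hp (.ambient i j)
        (F := fun z => ENNReal.ofReal (p.truncatedPower i (z i j)))
        (hφ.comp (measurable_coordLoc i j))
      simp only [meanFading, ENNReal.ofReal_one, one_mul] at this
      rw [← this]
      refine lintegral_congr fun ω => ?_
      rw [ambientPower_eq, ENNReal.ofReal_mul' (hp.truncatedPower_nonneg i _)]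
    simp_rw [this]
    rw [(hM.ppp i).tsum_lintegral hφ]
    exact (ENNReal.mul_lt_top ENNReal.ofReal_lt_top (hp.lintegral_truncatedPower_lt_top i)).ne
  filter_upwards [ae_lt_top' (AEMeasurable.tsum fun j =>
    (measurable_ambientPower hM hp i j).ennreal_ofReal.aemeasurable) hfin,
    ae_nonneg_fading hM] with ω hω hH
  refine (summable_congr fun j => ?_).1 (ENNReal.summable_toReal hω.ne)
  refine ENNReal.toReal_ofReal ?_
  rw [ambientPower_eq]
  exact mul_nonneg (hH _) (hp.truncatedPower_nonneg i _)

/-- The interference from tier `i`: fading is averaged out, then Campbell's formula relative to the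
serving base station applies. -/
lemma lintegral_interference (hM : p.IsModel μ X H) (hp : p.Admissible) (k i : Fin (n + 1))
    {B : Set ℝ} (hB : MeasurableSet B) :
    ∫⁻ ω in p.assoc X k ∩ p.servingDist X k ⁻¹' B, ENNReal.ofReal (p.interference X H k i ω) ∂μ =
      ∫⁻ ω in p.assoc X k ∩ p.servingDist X k ⁻¹' B,
        ENNReal.ofReal (p.meanInterference k i (p.servingDist X k ω)) ∂μ := by
  have hX := hM.measurable_loc
  have hA := measurableSet_assoc (p := p) hX k
  have hR := measurable_servingDist (p := p) hX k
  have hφ : Measurable fun x => ENNReal.ofReal (p.truncatedPower i x) :=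
    (hp.measurable_truncatedPower i).ennreal_ofReal
  have hf : Measurable (B.indicator (1 : ℝ → ℝ≥0∞)) := measurable_one.indicator hB
  set G : ℕ → Set Ω := fun j => p.assoc X k ∩ {ω | ¬ (i = k ∧ j = p.servingIdx X k ω)} with hG
  have hGm : ∀ j, MeasurableSet (G j) := measurableSet_assoc_not_serving hX k i
  have hpow : ∀ j, Measurable fun ω => ENNReal.ofReal (p.ambientPower X H i j ω) := fun j =>
    (measurable_ambientPower hM hp i j).ennreal_ofReal
  have hfR : Measurable fun ω => B.indicator (1 : ℝ → ℝ≥0∞) (p.servingDist X k ω) := hf.comp hR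
  have hwindow : ∀ F : Ω → ℝ≥0∞, ∫⁻ ω in p.assoc X k ∩ p.servingDist X k ⁻¹' B, F ω ∂μ =
      ∫⁻ ω in p.assoc X k, B.indicator 1 (p.servingDist X k ω) * F ω ∂μ := by
    intro F
    rw [Set.inter_comm, ← Measure.restrict_restrict (hR hB), ← lintegral_indicator (hR hB)]
    refine lintegral_congr fun ω => ?_
    by_cases h : p.servingDist X k ω ∈ B
    · rw [Set.indicator_of_mem (by exact h), Set.indicator_of_mem h, Pi.one_apply, one_mul]
    · rw [Set.indicator_of_notMem (by exact h), Set.indicator_of_notMem h, zero_mul]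
  rw [hwindow, hwindow]
  calc ∫⁻ ω in p.assoc X k, B.indicator 1 (p.servingDist X k ω) *
          ENNReal.ofReal (p.interference X H k i ω) ∂μ
      = ∫⁻ ω, ∑' j, (G j).indicator (fun ω => B.indicator 1 (p.servingDist X k ω) *
          ENNReal.ofReal (p.ambientPower X H i j ω)) ω ∂μ := by
        rw [← lintegral_indicator hA]
        refine lintegral_congr_ae ?_
        filter_upwards [ae_summable_ambientPower hM hp, ae_nonneg_fading hM] with ω hs hH
        by_cases hω : ω ∈ p.assoc X k
        · rw [Set.indicator_of_mem hω, interference, ENNReal.ofReal_tsum_of_nonneg,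
            ← ENNReal.tsum_mul_left]
          · refine tsum_congr fun j => ?_
            by_cases hj : i = k ∧ j = p.servingIdx X k ω
            · rw [if_pos hj, Set.indicator_of_notMem (show ω ∉ G j from fun h => h.2 hj),
                ENNReal.ofReal_zero, mul_zero]
            · rw [if_neg hj, Set.indicator_of_mem (show ω ∈ G j from ⟨hω, hj⟩)]
          · intro j
            split_ifs
            · exact le_rfl
            · rw [ambientPower_eq]; exact mul_nonneg (hH _) (hp.truncatedPower_nonneg i _)
          · refine (hs i).of_norm_bounded_eventually ?_ |>.congr fun _ => rfl
            refine Eventually.of_forall fun j => ?_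
            have h0 : 0 ≤ p.ambientPower X H i j ω := by
              rw [ambientPower_eq]; exact mul_nonneg (hH _) (hp.truncatedPower_nonneg i _)
            split_ifs
            · simpa using h0
            · rw [Real.norm_of_nonneg h0]
        · rw [Set.indicator_of_notMem hω]
          symm
          refine ENNReal.tsum_eq_zero.2 fun j => Set.indicator_of_notMem (fun h => hω h.1) _
    _ = ∑' j, ∫⁻ ω in G j, B.indicator 1 (p.servingDist X k ω) *
          ENNReal.ofReal (p.truncatedPower i (X i j ω)) ∂μ := by
        refine (lintegral_tsum fun j =>
          ((hfR.mul (hpow j)).indicator (hGm j)).aemeasurable).trans (tsum_congr fun j => ?_)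
        have := lintegral_fading_mul hM hp (.ambient i j)
          (F := (p.assoc (coordLoc n) k ∩
            {z | ¬ (i = k ∧ j = p.servingIdx (coordLoc n) k z)}).indicator fun z =>
              B.indicator 1 (p.servingDist (coordLoc n) k z) *
                ENNReal.ofReal (p.truncatedPower i (z i j)))
          (((hf.comp (measurable_servingDist measurable_coordLoc k)).mul
            (hφ.comp (measurable_coordLoc i j))).indicator (measurableSet_assoc_not_serving measurable_coordLoc k i j))
        simp only [meanFading, ENNReal.ofReal_one, one_mul] at this
        rw [← lintegral_indicator (hGm j)]
        refine Eq.trans (lintegral_congr fun ω => ?_) this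
        -- `coordLoc` evaluated at the random configuration is `X`, by definition
        change (G j).indicator _ ω = _ * (G j).indicator (fun ω => B.indicator 1
          (p.servingDist X k ω) * ENNReal.ofReal (p.truncatedPower i (X i j ω))) ω
        by_cases hω : ω ∈ G j
        · rw [Set.indicator_of_mem hω, Set.indicator_of_mem hω, Pi.mul_apply, ambientPower_eq,
            ENNReal.ofReal_mul' (hp.truncatedPower_nonneg i _), mul_left_comm]
        · rw [Set.indicator_of_notMem hω, Set.indicator_of_notMem hω, mul_zero]
    _ = _ := by
        rw [hM.campbell hp k i hf hφ]
        refine lintegral_congr fun ω => ?_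
        rw [hp.lintegral_truncatedPower_lt_attenuation k i (servingDist_nonneg k ω)]

end HetNet

namespace HetNet

variable {n : ℕ} {Ω : Type*} {p : HetNet n} {X : Fin (n + 1) → ℕ → Ω → Plane}
  {H : Link n → Ω → ℝ} [MeasurableSpace Ω] {μ : Measure Ω} [IsProbabilityMeasure μ]

lemma hasCondMean_interference (hM : p.IsModel μ X H) (hp : p.Admissible) (k i : Fin (n + 1)) :
    HasCondMean μ (p.assoc X k) (p.servingDist X k) (p.interference X H k i)
      (p.meanInterference k i) := by
  have hX := hM.measurable_loc
  have hI : Measurable (p.interference X H k i) := by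
    refine Measurable.tsum fun j => Measurable.ite ?_ measurable_const
      (measurable_ambientPower hM hp i j)
    exact (MeasurableSet.const _).inter
      (measurableSet_eq_fun measurable_const (measurable_servingIdx hX k))
  refine HasCondMean.of_lintegral (measurableSet_assoc hX k) (measurable_servingDist hX k)
    hI.aemeasurable ?_ (hp.continuous_meanInterference k i).measurable
    (fun ω => hp.meanInterference_nonneg k i (servingDist_nonneg k ω)) ?_
    fun B hB => lintegral_interference hM hp k i hB
  · filter_upwards [ae_nonneg_fading hM] with ω hH _
    refine tsum_nonneg fun j => ?_
    split_ifs
    · exact le_rfl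
    · rw [ambientPower_eq]; exact mul_nonneg (hH _) (hp.truncatedPower_nonneg i _)
  · refine ((lintegral_mono (g := fun _ => ENNReal.ofReal (p.lam i) *
      ∫⁻ x, ENNReal.ofReal (p.truncatedPower i x)) fun ω => ?_).trans_lt ?_).ne
    · rw [← hp.lintegral_truncatedPower_lt_attenuation k i (servingDist_nonneg k ω)]
      exact mul_le_mul_right (setLIntegral_le_lintegral _ _) _
    · rw [lintegral_const]
      exact ENNReal.mul_lt_top (ENNReal.mul_lt_top ENNReal.ofReal_lt_top
        (hp.lintegral_truncatedPower_lt_top i)) (measure_lt_top _ _)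

/-- The power received from the serving base station through the link `l`. -/
lemma hasCondMean_serving (hM : p.IsModel μ X H) (hp : p.Admissible) (k : Fin (n + 1))
    (l : Link n) :
    HasCondMean μ (p.assoc X k) (p.servingDist X k)
      (fun ω => H l ω * p.pathLoss k (max (p.servingDist X k ω) p.d))
      (fun x => p.meanFading l * p.pathLoss k (max x p.d)) := by
  have hX := hM.measurable_loc
  have hA := measurableSet_assoc (p := p) hX k
  have hR := measurable_servingDist (p := p) hX k
  have hL : Measurable fun r => p.pathLoss k (max r p.d) := (hp.continuous_pathLoss_max k).measurable
  have hL0 : ∀ r, 0 ≤ p.pathLoss k (max r p.d) := fun r => (hp.pathLoss_max_pos k r).le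
  have hl := meanFading_nonneg (p := p) l
  refine HasCondMean.of_lintegral hA hR
    ((hM.measurable_fading l).mul (hL.comp hR)).aemeasurable ?_ (hL.const_mul _)
    (fun ω => mul_nonneg hl (hL0 _)) ?_ fun B hB => ?_
  · filter_upwards [ae_nonneg_fading hM] with ω hH _ using mul_nonneg (hH l) (hL0 _)
  · refine ((lintegral_mono (g := fun _ =>
      ENNReal.ofReal (p.meanFading l * p.pathLoss k p.d)) fun ω => ?_).trans_lt ?_).ne
    · refine ENNReal.ofReal_le_ofReal (mul_le_mul_of_nonneg_left ?_ hl)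
      refine mul_le_mul_of_nonneg_left ?_ hp.β_pos.le
      exact Real.rpow_le_rpow_of_nonpos hp.d_pos (le_max_right _ _) (by linarith [hp.α_pos k])
    · rw [lintegral_const]
      exact ENNReal.mul_lt_top ENNReal.ofReal_lt_top (measure_lt_top _ _)
  · have hmem := hA.inter (hR hB)
    have hR' := measurable_servingDist (p := p) (measurable_coordLoc (n := n)) k
    have hA' := measurableSet_assoc (p := p) (measurable_coordLoc (n := n)) k
    have := lintegral_fading_mul hM hp l
      (F := (p.assoc (coordLoc n) k ∩ p.servingDist (coordLoc n) k ⁻¹' B).indicator fun z =>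
        ENNReal.ofReal (p.pathLoss k (max (p.servingDist (coordLoc n) k z) p.d)))
      ((hL.comp hR').ennreal_ofReal.indicator (hA'.inter (hR' hB)))
    rw [← lintegral_indicator hmem]
    simp_rw [ENNReal.ofReal_mul hl]
    have hLR : Measurable fun ω =>
        ENNReal.ofReal (p.pathLoss k (max (p.servingDist X k ω) p.d)) :=
      (hL.comp hR).ennreal_ofReal
    rw [lintegral_const_mul _ hLR, ← lintegral_indicator hmem]
    refine Eq.trans (lintegral_congr fun ω => ?_) this
    -- `coordLoc` evaluated at the random configuration is `X`, by definition
    change _ = _ * (p.assoc X k ∩ p.servingDist X k ⁻¹' B).indicator (fun ω =>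
      ENNReal.ofReal (p.pathLoss k (max (p.servingDist X k ω) p.d))) ω
    by_cases hω : ω ∈ p.assoc X k ∩ p.servingDist X k ⁻¹' B
    · rw [Set.indicator_of_mem hω, Set.indicator_of_mem hω, ENNReal.ofReal_mul' (hL0 _)]
    · rw [Set.indicator_of_notMem hω, Set.indicator_of_notMem hω, mul_zero]

/-- A conditional mean given the serving distance that is continuous in that distance is a
conditional mean in the sense of `IsCondMean`. -/
lemma isCondMean_of_hasCondMean (hM : p.IsModel μ X H) (hp : p.Admissible) {k : Fin (n + 1)}
    {T : Ω → ℝ} {t g : ℝ → ℝ} (h : HasCondMean μ (p.assoc X k) (p.servingDist X k) T t)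
    (ht : Continuous t) (hg : ∀ x, 0 < x → g x = t x) :
    IsCondMean μ (p.assoc X k) (p.servingDist X k) T g := by
  have hX := hM.measurable_loc
  refine h.isCondMean (measurableSet_assoc hX k) (measurable_servingDist hX k) ?_ ht hg ?_
  · filter_upwards [hM.ae_generic hp] with ω hω _ using hω.norm_pos _ _
  · intro x hx ε hε h0
    refine hM.measure_assoc_inter_ne_zero hp k hx.le (lt_add_of_pos_right x hε)
      (measure_mono_null (Set.inter_subset_inter_right _ fun ω hω => ?_) h0)
    have h1 : x ≤ p.servingDist X k ω := hω.1
    have h2 : p.servingDist X k ω < x + ε := hω.2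
    change |p.servingDist X k ω - x| ≤ ε
    rw [abs_of_nonneg (by linarith)]
    linarith

end HetNet

/-! ### Closed forms -/

/-- The radial integral beyond the radius `r x ^ (a / b)`, with the case distinction transferred
from the radius to `x`. -/
lemma radialTail_mul_rpow {a b d r x : ℝ} (ha : 0 < a) (hb : 0 < b) (hd : 0 < d) (hr : 0 < r)
    (hx : 0 < x) : radialTail b d (r * x ^ (a / b)) =
      if x ≤ r ^ (-b / a) * d ^ (b / a) then
        d ^ (-b) * ((d ^ 2 - r ^ 2 * x ^ (2 * a / b)) / 2) - d ^ (2 - b) / (2 - b)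
      else -(r ^ (2 - b) * x ^ (a * (2 - b) / b) / (2 - b)) := by
  have hiff : r * x ^ (a / b) ≤ d ↔ x ≤ r ^ (-b / a) * d ^ (b / a) := by
    have hba : 0 < b / a := div_pos hb ha
    rw [← Real.rpow_le_rpow_iff (by positivity) hd.le hba,
      Real.mul_rpow hr.le (by positivity), ← Real.rpow_mul hx.le,
      show a / b * (b / a) = 1 by field_simp, Real.rpow_one, neg_div, Real.rpow_neg hr.le,
      inv_mul_eq_div, le_div_iff₀ (by positivity), mul_comm]
  rw [radialTail_eq_ite]
  simp only [hiff]
  congr 2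
  · rw [mul_pow, ← Real.rpow_natCast (x ^ (a / b)), ← Real.rpow_mul hx.le]
    congr 4
    push_cast
    ring_nf
  · rw [Real.mul_rpow hr.le (by positivity), ← Real.rpow_mul hx.le]
    congr 3
    ring_nf

namespace HetNet

variable {n : ℕ} {p : HetNet n}

lemma Admissible.exclusionRadius_eq (hp : p.Admissible) (k i : Fin (n + 1)) {x : ℝ} (hx : 0 ≤ x) :
    p.exclusionRadius k i x =
      (p.assocPower k / p.assocPower i) ^ (-1 / p.α i) * x ^ (p.α k / p.α i) := by
  have hk := hp.assocPower_pos k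
  have hi := hp.assocPower_pos i
  unfold exclusionRadius distOfAttenuation attenuation
  rw [show p.assocPower i * (x ^ p.α k / p.assocPower k) =
      (p.assocPower k / p.assocPower i)⁻¹ * x ^ p.α k by field_simp,
    Real.mul_rpow (by positivity) (by positivity), ← Real.rpow_mul hx, neg_div,
    Real.rpow_neg (by positivity), Real.inv_rpow (by positivity), mul_one_div]

lemma Admissible.radialTail_exclusionRadius (hp : p.Admissible) (k i : Fin (n + 1)) {q x : ℝ}
    (hq : q = p.assocPower k / p.assocPower i) (hx : 0 < x) :
    radialTail (p.α i) p.d (p.exclusionRadius k i x) =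
      if x ≤ (q ^ (-1 / p.α i)) ^ (-p.α i / p.α k) * p.d ^ (p.α i / p.α k) then
        p.d ^ (-p.α i) * ((p.d ^ 2 - (q ^ (-1 / p.α i)) ^ 2 * x ^ (2 * p.α k / p.α i)) / 2)
          - p.d ^ (2 - p.α i) / (2 - p.α i)
      else -((q ^ (-1 / p.α i)) ^ (2 - p.α i) * x ^ (p.α k * (2 - p.α i) / p.α i)
        / (2 - p.α i)) := by
  have hq0 : 0 < q := hq ▸ div_pos (hp.assocPower_pos k) (hp.assocPower_pos i)
  rw [hp.exclusionRadius_eq k i hx.le, ← hq]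
  exact radialTail_mul_rpow (hp.α_pos k) (hp.α_pos i) hp.d_pos (Real.rpow_pos_of_pos hq0 _) hx

lemma Admissible.exclusionRadius_self (hp : p.Admissible) (k : Fin (n + 1)) {x : ℝ} (hx : 0 ≤ x) :
    p.exclusionRadius k k x = x :=
  hp.distOfAttenuation_attenuation k hx

lemma max_rpow_eq_ite (d x a : ℝ) :
    max x d ^ a = if x ≤ d then d ^ a else x ^ a := by
  split_ifs with h
  · rw [max_eq_right h]
  · rw [max_eq_left (not_le.1 h).le]

lemma assocPower_zero : p.assocPower 0 = p.gain * (p.P 0 / p.S) := if_pos rfl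

lemma assocPower_succ (i : Fin n) : p.assocPower i.succ = p.P i.succ := if_neg (Fin.succ_ne_zero i)

lemma Admissible.meanMacro_eq (hp : p.Admissible) {x : ℝ} (hx : 0 < x) : p.meanMacro x =
    p.η * p.P 0 * (p.τ * p.T / p.S) * (p.meanFading .directed * p.pathLoss 0 (max x p.d))
    + p.η * p.P 0 * (((p.S : ℝ) - 1) * p.τ * p.T / p.S) *
        (p.meanFading .shared * p.pathLoss 0 (max x p.d))
    + p.η * (p.τ * p.T) *
        (p.meanInterference 0 0 x + ∑ i : Fin n, p.meanInterference 0 i.succ x) := by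
  have hS := hp.S_cast_pos
  have hsum : ∑ i : Fin n, p.meanInterference 0 i.succ x = ∑ i : Fin n,
      p.P i.succ * p.β * 2 * Real.pi * p.lam i.succ
        * (if x ≤ p.dO i then
            p.d ^ (-p.α i.succ) * ((p.d ^ 2 - p.rMS i ^ 2 * x ^ (2 * p.α 0 / p.α i.succ)) / 2)
              - p.d ^ (2 - p.α i.succ) / (2 - p.α i.succ)
          else -(p.rMS i ^ (2 - p.α i.succ) * x ^ (p.α 0 * (2 - p.α i.succ) / p.α i.succ)
              / (2 - p.α i.succ))) := by
    refine Finset.sum_congr rfl fun i _ => ?_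
    have hP := hp.P_pos i.succ
    have hq : p.gain * (p.P 0 / (p.S * p.P i.succ)) = p.assocPower 0 / p.assocPower i.succ := by
      rw [assocPower_zero, assocPower_succ]; field_simp
    rw [meanInterference, hp.radialTail_exclusionRadius 0 i.succ hq hx, dO, rMS]
    ring
  rw [hsum, meanMacro, meanInterference, hp.exclusionRadius_self 0 hx.le, radialTail_eq_ite,
    pathLoss, max_rpow_eq_ite]
  simp only [meanFading]
  field_simp
  ring

lemma Admissible.meanSmall_eq (hp : p.Admissible) (k : Fin n) {y : ℝ} (hy : 0 < y) :
    p.meanSmall k y =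
    p.η * p.P k.succ * (p.τ * p.T) * (p.meanFading .small * p.pathLoss k.succ (max y p.d))
    + p.η * (p.τ * p.T) *
        (p.meanInterference k.succ 0 y + ∑ i : Fin n, p.meanInterference k.succ i.succ y) := by
  have hS := hp.S_cast_pos
  have hP0 := hp.P_pos 0
  have hG := one_pos.trans_le hp.one_le_gain
  have hsum : ∑ i : Fin n, p.meanInterference k.succ i.succ y = ∑ i : Fin n,
      p.P i.succ * p.β * 2 * Real.pi * p.lam i.succ
        * (if y ≤ p.dTwo k i then
            p.d ^ (-p.α i.succ)
                * ((p.d ^ 2 - p.rSS k i ^ 2 * y ^ (2 * p.α k.succ / p.α i.succ)) / 2)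
              - p.d ^ (2 - p.α i.succ) / (2 - p.α i.succ)
          else -(p.rSS k i ^ (2 - p.α i.succ)
              * y ^ (p.α k.succ * (2 - p.α i.succ) / p.α i.succ) / (2 - p.α i.succ))) := by
    refine Finset.sum_congr rfl fun i _ => ?_
    have hq : p.P k.succ / p.P i.succ = p.assocPower k.succ / p.assocPower i.succ := by
      rw [assocPower_succ, assocPower_succ]
    rw [meanInterference, hp.radialTail_exclusionRadius k.succ i.succ hq hy, dTwo, rSS]
    ring
  have hq : p.S * p.P k.succ / (p.gain * p.P 0) = p.assocPower k.succ / p.assocPower 0 := by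
    rw [assocPower_zero, assocPower_succ]; field_simp
  rw [hsum, meanSmall, meanInterference, hp.radialTail_exclusionRadius k.succ 0 hq hy,
    pathLoss, max_rpow_eq_ite, dOne, rSM]
  simp only [meanFading]
  ring

end HetNet

theorem theorem1 {Ω : Type*} [MeasurableSpace Ω] (μ : Measure Ω) [IsProbabilityMeasure μ]
    {n : ℕ} (p : HetNet n) (hp : p.Admissible)
    (X : Fin (n + 1) → ℕ → Ω → Plane) (H : Link n → Ω → ℝ) (hM : p.IsModel μ X H) :
    (∀ᵐ ω ∂μ, ∀ i, Summable fun j => p.ambientPower X H i j ω) ∧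
    IsCondMean μ (p.assoc X 0) (p.servingDist X 0) (p.energyMacro X H) p.meanMacro ∧
    ∀ k : Fin n, IsCondMean μ (p.assoc X k.succ) (p.servingDist X k.succ)
      (p.energySmall X H k) (p.meanSmall k) := by
  have hI := HetNet.hasCondMean_interference hM hp
  have hL := HetNet.hasCondMean_serving hM hp
  have hIc : ∀ k i, Continuous (p.meanInterference k i) := hp.continuous_meanInterference
  have hLc := hp.continuous_pathLoss_max
  have hIall := fun k => (hI k 0).add
    (HasCondMean.sum Finset.univ fun (i : Fin n) _ => hI k i.succ)
  have hIallc : ∀ k, Continuous fun x =>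
      p.meanInterference k 0 x + ∑ i : Fin n, p.meanInterference k i.succ x := fun k =>
    (hIc k 0).add (continuous_finsetSum _ fun i _ => hIc k i.succ)
  refine ⟨HetNet.ae_summable_ambientPower hM hp, ?_, fun k => ?_⟩
  · have h := (((hL 0 .directed).const_mul (p.η * p.P 0 * (p.τ * p.T / p.S))).add
      ((hL 0 .shared).const_mul (p.η * p.P 0 * (((p.S : ℝ) - 1) * p.τ * p.T / p.S)))).add
      ((hIall 0).const_mul (p.η * (p.τ * p.T)))
    have hE : p.energyMacro X H = _ := funext fun ω =>
      show p.energyMacro X H ω =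
        p.η * p.P 0 * (p.τ * p.T / p.S) *
            (H .directed ω * p.pathLoss 0 (max (p.servingDist X 0 ω) p.d))
          + p.η * p.P 0 * (((p.S : ℝ) - 1) * p.τ * p.T / p.S) *
            (H .shared ω * p.pathLoss 0 (max (p.servingDist X 0 ω) p.d))
          + p.η * (p.τ * p.T) * (p.interference X H 0 0 ω
            + ∑ i : Fin n, p.interference X H 0 i.succ ω) by
        rw [HetNet.energyMacro]; ring
    rw [hE]
    exact HetNet.isCondMean_of_hasCondMean hM hp h
      (((((hLc 0).const_mul _).const_mul _).add (((hLc 0).const_mul _).const_mul _)).add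
        ((hIallc 0).const_mul _)) fun x hx => hp.meanMacro_eq hx
  · have h := ((hL k.succ .small).const_mul (p.η * p.P k.succ * (p.τ * p.T))).add
      ((hIall k.succ).const_mul (p.η * (p.τ * p.T)))
    have hE : p.energySmall X H k = _ := funext fun ω =>
      show p.energySmall X H k ω =
        p.η * p.P k.succ * (p.τ * p.T) *
            (H .small ω * p.pathLoss k.succ (max (p.servingDist X k.succ ω) p.d))
          + p.η * (p.τ * p.T) * (p.interference X H k.succ 0 ω
            + ∑ i : Fin n, p.interference X H k.succ i.succ ω) by
        rw [HetNet.energySmall]; ring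
    rw [hE]
    exact HetNet.isCondMean_of_hasCondMean hM hp h
      ((((hLc k.succ).const_mul _).const_mul _).add ((hIallc k.succ).const_mul _))
      fun x hx => hp.meanSmall_eq k hx
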